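/- **Proposition (Multiple-interval quasimatrix operators).** *Functions.* Let $T_n,U_n$ be the Chebyshev polynomials of the first and second kind. For $n\ge 0$ and $x\in\mathbb R$ put $W_n(x)=\sqrt{1-x^2}\,U_n(x)$ and $V_n(x)=T_n(x)/\sqrt{1-x^2}$ if $|x|<1$, and $W_n(x)=V_n(x)=0$ if $|x|\ge 1$; $\tilde T_n(x)=T_n(x)$ if $|x|\le 1$ and $\tilde T_n(x)=(x-\operatorname{sgn}(x)\sqrt{x^2-1})^n$ if $|x|>1$; $\tilde U_{-2}(x)=\tilde U_{-1}(x)=0$ if $|x|\le 1$, $\tilde U_{-2}(x)=-|x|/\sqrt{x^2-1}$ and $\tilde U_{-1}(x)=-\operatorname{sgn}(x)/\sqrt{x^2-1}$ if $|x|>1$, $\tilde U_0=\tilde T_0+\tilde U_{-2}$, and $\tilde U_n=2\tilde T_n+\tilde U_{n-2}$ for $n\ge 1$. For $I=[a,b]$, $a<b$, a superscript $I$ means composition with the affine map $x\mapsto \frac{2}{b-a}\left(x-\frac{a+b}{2}\right)$. *Operators.* $\mathcal H[u](x)=\frac1\pi\,\mathrm{p.v.}\!\int_{\mathbb R}\frac{u(y)}{x-y}\,dy$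 and $(-\Delta)^{1/2}u(x)=c_{1/2}\,\mathrm{p.v.}\!\int_{\mathbb R}\frac{u(x)-u(y)}{|x-y|^{2}}\,dy$ with $c_s=\frac{4^s\,\Gamma(1/2+s)}{\pi^{1/2}|\Gamma(-s)|}$, where $\mathrm{p.v.}\!\int=\lim_{\varepsilon\to0^+,\,R\to\infty}\int_{\varepsilon<|x-y|<R}$. In the sense of distributions, $\frac{d}{dx}u=g$ means $\int g\varphi=-\int u\varphi'$, and $(-\Delta)^{1/2}u=g$ means $\int g\varphi=\int u\,(-\Delta)^{1/2}\varphi$, for all Schwartz functions $\varphi$ (all integrals being absolutely convergent). *One interval.* For $n\ge0$ let $$S^I_n=\big(\tilde T^I_0\,|\,W^I_0\ \tilde T^I_1\,|\cdots|\,W^I_n\ \tilde T^I_{n+1}\big),\qquad S^{I,*}_n=\big(\tilde U^I_{-2}\,|\,V^I_0\ \tilde U^I_{-1}\,|\cdots|\,V^I_{n+2}\ \tilde U^I_{n+1}\big),$$ and let $S^{\circ,I}_n$, $S^{\circ,I,*}_n$ be these rows without their first entry. Let $N=\begin{pmatrix}-1&0\\0&1\end{pmatrix}$ and $M=\begin{pmatrix}0&1\\1&0\end{pmatrix}$.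 The matrices $E_n,H_n,D^I_n,A^I_n\in\mathbb R^{(2n+7)\times(2n+3)}$ consist of a first row, a first column, and $2\times2$ blocks with block rows $0,\dots,n+2$ and block columns $0,\dots,n$. Block column $j$ of $E_n$ (respectively $H_n$) has $-N/2$ (respectively $-M/2$) in block row $j$ and $N/2$ (respectively $M/2$) in block row $j+2$. Block column $j$ of $D^I_n$ (respectively $A^I_n$) has $\frac{2(j+1)}{b-a}N$ (respectively $\frac{2(j+1)}{b-a}M$) in block row $j+1$. The first column of $E_n$ has $-1$ in the first row and $(0,1)^\top$ in block row $1$. All other entries of the four matrices are zero. For such a matrix, $B^\dagger$ denotes $B$ without its first row and first column. *Several intervals.* Let $K\ge1$ and let $I_k=[a_k,b_k]$, $a_k<b_k$, $k=1,\dots,K$, have pairwise disjoint interiors. Let $n_1,\dots,n_K\ge0$, $\mathbf S=\big(S^{I_1}_{n_1}|S^{\circ,I_2}_{n_2}|\cdots|S^{\circ,I_K}_{n_K}\big)$ and $\mathbf S^*=\big(S^{I_1,*}_{n_1}|S^{\circ,I_2,*}_{n_2}|\cdots|S^{\circ,I_K,*}_{n_K}\big)$. Let $$\mathbf E=\operatorname{diag}\big(E_{n_1},E_{n_2}^\dagger,\dots,E_{n_K}^\dagger\big),\qquad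 \mathbf H=\operatorname{diag}\big(H_{n_1},H_{n_2}^\dagger,\dots,H_{n_K}^\dagger\big),$$ $$\mathbf D=\operatorname{diag}\big(D^{I_1}_{n_1},(D^{I_2}_{n_2})^\dagger,\dots,(D^{I_K}_{n_K})^\dagger\big),\qquad \mathbf A=\operatorname{diag}\big(A^{I_1}_{n_1},(A^{I_2}_{n_2})^\dagger,\dots,(A^{I_K}_{n_K})^\dagger\big),$$ block diagonal matrices of size $\big(1+2\sum_k n_k+6K\big)\times\big(1+2\sum_k n_k+2K\big)$. *Claim.* For every $x\in\mathbb R$, $$\mathbf S(x)=\mathbf S^*(x)\,\mathbf E,\qquad \mathcal H[\mathbf S](x)=\mathbf S^*(x)\,\mathbf H,$$ and for every $x\in\mathbb R$ that is not an end point of any $I_k$, $$\tfrac{d}{dx}\mathbf S(x)=\mathbf S^*(x)\,\mathbf D,\qquad (-\Delta)^{1/2}[\mathbf S](x)=\mathbf S^*(x)\,\mathbf A,$$ where the operators act on each column and all the principal values and derivatives exist; the last two identities also hold, column by column, in the sense of distributions. Hence, for $\lambda,\mu,\eta\in\mathbb R$, the matrix $\mathbf L=\lambda\mathbf E+\mu\mathbf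 H+\eta\mathbf D+\mathbf A$ is block diagonal with the blocks $L_1,L_2^\dagger,\dots,L_K^\dagger$, where $L_k=\lambda E_{n_k}+\mu H_{n_k}+\eta D^{I_k}_{n_k}+A^{I_k}_{n_k}$, and $$\big(\lambda\mathcal I+\mu\mathcal H+\eta\tfrac{d}{dx}+(-\Delta)^{1/2}\big)[\mathbf S\,c](x)=\mathbf S^*(x)\,\mathbf L\,c$$ for every coefficient vector $c$ and every $x$ that is not an end point of any $I_k$: the operator decouples across the intervals. -/

import Mathlib

open MeasureTheory Filter Topology Matrix
open scoped SchwartzMap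

namespace SumSpace

noncomputable section

/-! ### Principal values and the operators -/

/-- `v` is the Cauchy principal value of the integral of `f` over the real line, with the
singularity at `x` and the point at infinity treated symmetrically:
`v = lim ∫_{ε < |x - y| < R} f y dy` as `ε → 0+` and `R → ∞`. -/
def HasPrincipalValue (f : ℝ → ℝ) (x v : ℝ) : Prop :=
  (∀ ε R : ℝ, 0 < ε → IntegrableOn f {y | ε < |x - y| ∧ |x - y| < R}) ∧
  Tendsto (fun p : ℝ × ℝ => ∫ y in {y | p.1 < |x - y| ∧ |x - y| < p.2}, f y)
    (𝓝[>] 0 ×ˢ atTop) (𝓝 v)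

/-- The Hilbert transform of `u` at `x` exists and equals `v`:
`v = (1/π) p.v. ∫ u(y)/(x - y) dy`. -/
def HasHilbertAt (u : ℝ → ℝ) (x v : ℝ) : Prop :=
  ∃ I : ℝ, HasPrincipalValue (fun y => u y / (x - y)) x I ∧ v = 1 / Real.pi * I

/-- The constant `c_s = 4^s Γ(1/2 + s) / (π^(1/2) |Γ(-s)|)` of the fractional Laplacian. -/
def fracLaplacianConst (s : ℝ) : ℝ :=
  4 ^ s * Real.Gamma (1 / 2 + s) / (Real.pi ^ (1 / 2 : ℝ) * |Real.Gamma (-s)|)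

/-- The singular integral of `(-Δ)^s u` at `x` exists and equals `v`:
`v = c_s p.v. ∫ (u(x) - u(y)) / |x - y|^(1 + 2s) dy`. -/
def HasFracLaplacianAt (s : ℝ) (u : ℝ → ℝ) (x v : ℝ) : Prop :=
  ∃ I : ℝ, HasPrincipalValue (fun y => (u x - u y) / |x - y| ^ (1 + 2 * s)) x I ∧
    v = fracLaplacianConst s * I

/-- `(-Δ)^s u = g` in the sense of tempered distributions: for every Schwartz function `φ`,
with `ψ = (-Δ)^s φ` given by the singular integral, `∫ g φ = ∫ u ψ`. -/
def IsFracLaplacian (s : ℝ) (u g : ℝ → ℝ) : Prop :=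
  ∀ φ : 𝓢(ℝ, ℝ), ∃ ψ : ℝ → ℝ, (∀ x, HasFracLaplacianAt s φ x (ψ x)) ∧
    Integrable (fun x => g x * φ x) ∧ Integrable (fun x => u x * ψ x) ∧
    ∫ x, g x * φ x = ∫ x, u x * ψ x

/-- `du/dx = g` in the sense of tempered distributions. -/
def IsWeakDeriv (u g : ℝ → ℝ) : Prop :=
  ∀ φ : 𝓢(ℝ, ℝ),
    Integrable (fun x => g x * φ x) ∧ Integrable (fun x => u x * deriv φ x) ∧
    ∫ x, g x * φ x = - ∫ x, u x * deriv φ x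

/-- `v = (lam I + mu H + eta d/dx + (-Δ)^(1/2)) u` at the point `x`, all terms existing. -/
def HasOperatorAt (lam mu eta : ℝ) (u : ℝ → ℝ) (x v : ℝ) : Prop :=
  ∃ h d r : ℝ, HasHilbertAt u x h ∧ HasDerivAt u d x ∧ HasFracLaplacianAt (1 / 2) u x r ∧
    v = lam * u x + mu * h + eta * d + r

/-! ### Weighted and extended Chebyshev functions -/

/-- `W_n(x) = (1 - x^2)_+^(1/2) U_n(x)`. -/
def wU (n : ℕ) (x : ℝ) : ℝ :=
  if |x| < 1 then √(1 - x ^ 2) * (Polynomial.Chebyshev.U ℝ n).eval x else 0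

/-- `V_n(x) = (1 - x^2)_+^(-1/2) T_n(x)`. -/
def wT (n : ℕ) (x : ℝ) : ℝ :=
  if |x| < 1 then (√(1 - x ^ 2))⁻¹ * (Polynomial.Chebyshev.T ℝ n).eval x else 0

/-- The extended Chebyshev function of the first kind, of degree `n`. -/
def extT (n : ℕ) (x : ℝ) : ℝ :=
  if |x| ≤ 1 then (Polynomial.Chebyshev.T ℝ n).eval x
  else (x - Real.sign x * √(x ^ 2 - 1)) ^ n

/-- The extended Chebyshev functions of the second kind, with the index shifted by two:
`extU m` is the function of index `m - 2`, so `extU 0` has index `-2` and `extU 1` has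
index `-1`. -/
def extU : ℕ → ℝ → ℝ
  | 0, x => if |x| ≤ 1 then 0 else -(|x| / √(x ^ 2 - 1))
  | 1, x => if |x| ≤ 1 then 0 else -(Real.sign x / √(x ^ 2 - 1))
  | 2, x => extT 0 x + extU 0 x
  | m + 3, x => 2 * extT (m + 1) x + extU (m + 1) x

/-- The affine map that takes `[a, b]` to `[-1, 1]`. -/
def aff (a b x : ℝ) : ℝ := 2 / (b - a) * (x - (a + b) / 2)

/-! ### Quasimatrices centred at one interval -/

/-- Column indices of the sum space quasimatrix: one first column, then blocks `0, …, n` of two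
columns each. -/
abbrev ColIdx (n : ℕ) : Type := Unit ⊕ Fin (n + 1) × Fin 2

/-- Column indices of the dual sum space quasimatrix: one first column, then blocks
`0, …, n + 2` of two columns each. -/
abbrev RowIdx (n : ℕ) : Type := Unit ⊕ Fin (n + 3) × Fin 2

/-- The row vector `(T̃_0 | W_0 T̃_1 | … | W_n T̃_{n+1})` at `x`, centred at `[a, b]`. -/
def sumSpace (a b : ℝ) (n : ℕ) (x : ℝ) : ColIdx n → ℝ :=
  Sum.elim (fun _ => extT 0 (aff a b x))
    (fun p => ![wU p.1 (aff a b x), extT (p.1 + 1) (aff a b x)] p.2)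

/-- The row vector `(Ũ_{-2} | V_0 Ũ_{-1} | … | V_{n+2} Ũ_{n+1})` at `x`, centred at `[a, b]`. -/
def dualSumSpace (a b : ℝ) (n : ℕ) (x : ℝ) : RowIdx n → ℝ :=
  Sum.elim (fun _ => extU 0 (aff a b x))
    (fun p => ![wT p.1 (aff a b x), extU (p.1 + 1) (aff a b x)] p.2)

/-- The `2 × 2` block `N`. -/
def blockN : Matrix (Fin 2) (Fin 2) ℝ := !![-1, 0; 0, 1]

/-- The `2 × 2` block `M`. -/
def blockM : Matrix (Fin 2) (Fin 2) ℝ := !![0, 1; 1, 0]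

/-- The block part with `-B/2` on the block diagonal, zero blocks below it, and `B/2` two block
rows below the diagonal. -/
def bandTwo (n : ℕ) (B : Matrix (Fin 2) (Fin 2) ℝ) :
    Matrix (Fin (n + 3) × Fin 2) (Fin (n + 1) × Fin 2) ℝ :=
  Matrix.of fun p q =>
    if p.1.val = q.1.val then -(B p.2 q.2 / 2)
    else if p.1.val = q.1.val + 2 then B p.2 q.2 / 2
    else 0

/-- The block part with `2(j+1)/(b-a) B` in block row `j + 1` of block column `j`. -/
def bandOne (a b : ℝ) (n : ℕ) (B : Matrix (Fin 2) (Fin 2) ℝ) :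
    Matrix (Fin (n + 3) × Fin 2) (Fin (n + 1) × Fin 2) ℝ :=
  Matrix.of fun p q =>
    if p.1.val = q.1.val + 1 then 2 * ((q.1.val : ℝ) + 1) / (b - a) * B p.2 q.2 else 0

/-- The matrix `E` of the identity: first column `(-1, 0, e₂, 0, …)`. -/
def matE (n : ℕ) : Matrix (RowIdx n) (ColIdx n) ℝ :=
  fromBlocks (Matrix.of fun _ _ => -1) 0
    (Matrix.of fun p _ => if p.1.val = 1 ∧ p.2 = 1 then 1 else 0)
    (bandTwo n blockN)

/-- The matrix `H` of the Hilbert transform. -/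
def matH (n : ℕ) : Matrix (RowIdx n) (ColIdx n) ℝ :=
  fromBlocks 0 0 0 (bandTwo n blockM)

/-- The matrix `D` of the derivative. -/
def matD (a b : ℝ) (n : ℕ) : Matrix (RowIdx n) (ColIdx n) ℝ :=
  fromBlocks 0 0 0 (bandOne a b n blockN)

/-- The matrix `A` of the sqrt-Laplacian. -/
def matA (a b : ℝ) (n : ℕ) : Matrix (RowIdx n) (ColIdx n) ℝ :=
  fromBlocks 0 0 0 (bandOne a b n blockM)

/-! ### Quasimatrices for the intervals `[a k, b k]`, `k = 0, …, K`

There are `K + 1` intervals; the one with index `0` is the distinguished first interval, whose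
block keeps its first row and column. -/

/-- Column indices of the multiple-interval sum space quasimatrix. -/
abbrev MultiCol {K : ℕ} (n : Fin (K + 1) → ℕ) : Type :=
  ColIdx (n 0) ⊕ (Σ k : Fin K, Fin (n k.succ + 1) × Fin 2)

/-- Column indices of the dual multiple-interval sum space quasimatrix. -/
abbrev MultiRow {K : ℕ} (n : Fin (K + 1) → ℕ) : Type :=
  RowIdx (n 0) ⊕ (Σ k : Fin K, Fin (n k.succ + 3) × Fin 2)

/-- With `K + 1` intervals and `N = ∑ n_k` there are `1 + 2N + 2(K + 1)` columns. -/
theorem card_multiCol {K : ℕ} (n : Fin (K + 1) → ℕ) :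
    Fintype.card (MultiCol n) = 1 + 2 * ∑ k, n k + 2 * (K + 1) := by
  simp [MultiCol, ColIdx, Fin.sum_univ_succ, ← Finset.sum_mul, Finset.sum_add_distrib]
  ring

/-- With `K + 1` intervals and `N = ∑ n_k` there are `1 + 2N + 6(K + 1)` rows. -/
theorem card_multiRow {K : ℕ} (n : Fin (K + 1) → ℕ) :
    Fintype.card (MultiRow n) = 1 + 2 * ∑ k, n k + 6 * (K + 1) := by
  simp [MultiRow, RowIdx, Fin.sum_univ_succ, ← Finset.sum_mul, Finset.sum_add_distrib]
  ring

/-- The multiple-interval sum space quasimatrix at `x`: the full block of the first interval, then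
the blocks of the other intervals without their first (constant) column. -/
def multiSumSpace {K : ℕ} (a b : Fin (K + 1) → ℝ) (n : Fin (K + 1) → ℕ) (x : ℝ) :
    MultiCol n → ℝ :=
  Sum.elim (sumSpace (a 0) (b 0) (n 0) x)
    (fun q => sumSpace (a q.1.succ) (b q.1.succ) (n q.1.succ) x (Sum.inr q.2))

/-- The dual multiple-interval sum space quasimatrix at `x`. -/
def multiDualSumSpace {K : ℕ} (a b : Fin (K + 1) → ℝ) (n : Fin (K + 1) → ℕ) (x : ℝ) :
    MultiRow n → ℝ :=
  Sum.elim (dualSumSpace (a 0) (b 0) (n 0) x)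
    (fun q => dualSumSpace (a q.1.succ) (b q.1.succ) (n q.1.succ) x (Sum.inr q.2))

/-- The block diagonal matrix with blocks `B 0, (B 1)†, …, (B K)†`, where `†` removes the first
row and the first column. -/
def multiBlock {K : ℕ} (n : Fin (K + 1) → ℕ)
    (B : (k : Fin (K + 1)) → Matrix (RowIdx (n k)) (ColIdx (n k)) ℝ) :
    Matrix (MultiRow n) (MultiCol n) ℝ :=
  fromBlocks (B 0) 0 0 (blockDiagonal' fun k : Fin K => (B k.succ).toBlocks₂₂)

end

end SumSpace

open SumSpace

/-!
Let `J(w) = w - √(w + 1) √(w - 1)` be the inverse Joukowski map, with square roots taken in the first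
quadrant. It is holomorphic in the upper half plane, continuous up to the real line, bounded by `1`
and by `1 / |w|`. By de Moivre's formula the boundary values of its powers are
`J^(m+1) = T̃_{m+1} - i W_m`, and those of the derivative are
`(J^(m+1))' = (m + 1) (Ũ_m + i V_{m+1})` away from `±1`; see `joukowski_pow_ofReal` and
`joukowskiPowDeriv_eq`. So the columns are real and imaginary parts of boundary values of bounded
holomorphic functions, and `J^0 = 1` accounts for the constant column.

For such a function `F` with limit `c` at infinity, the Hilbert transform is `-i (F - c)` and
`(-Δ)^(1/2) F = -i F'`. Both come from one contour integral: if `g` is holomorphic in the upper half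
plane, then Cauchy's theorem on a half annulus about `x` (the image of a rectangle under the
exponential, `integral_half_annulus`) expresses the truncated integral of `g` over the real line by
integrals over two half circles, and these converge with `(z - x) g(z)` at `x` and at infinity
(`tendsto_integral_boundary`). The choices `g(z) = F(z) / (x - z)` and
`g(z) = (F(x) - F(z)) / (x - z)²` give the two operators. Taking real and imaginary parts yields the
images of `T̃_{m+1}` and `W_m` at once, also at the end points in the case of the Hilbert transform.

For the weak form of `(-Δ)^(1/2)`, Fubini's theorem moves the truncated second difference from the
test function to the column. The same contour formula bounds the truncated integrals, uniformly in
the radii, by a multiple of `|x - a|^(-1/2) + |x - b|^(-1/2)`, because the difference quotients of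
`F` at `x` are so bounded in the whole half plane; dominated convergence then applies
(`isFracLaplacian_of_dominated`). The weak derivative is integration by parts off the end points.

Each column over several intervals is centred at one of them, and a block diagonal matrix acts on it
through the block of that interval (`exists_col`), so the statement reduces to band matrix identities
on a single interval, which are the recurrences defining `Ũ` and `2 (1 - x²) U_m = T_m - T_{m+2}`.
-/

namespace SumSpace

noncomputable section

/-! ### Principal values by symmetric differences -/

/-- The integral over a symmetric annulus, folded to one side of its centre. -/
theorem integral_annulus {E : Type*} [NormedAddCommGroup E] [NormedSpace ℝ E] {f : ℝ → E} {x : ℝ}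
    (hf : ContinuousOn f {x}ᶜ) {ε R : ℝ} (hε : 0 < ε) (hR : ε ≤ R) :
    ∫ y in {y | ε < |x - y| ∧ |x - y| < R}, f y = ∫ r in ε..R, (f (x + r) + f (x - r)) := by
  have hset : {y | ε < |x - y| ∧ |x - y| < R} =
      Set.Ioo (x - R) (x - ε) ∪ Set.Ioo (x + ε) (x + R) := by
    ext y
    simp only [Set.mem_ofPred_eq, Set.mem_union, Set.mem_Ioo, abs_lt, lt_abs]
    constructor
    · rintro ⟨h | h, h1, h2⟩
      · left; constructor <;> linarith
      · right; constructor <;> linarith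
    · rintro (⟨h1, h2⟩ | ⟨h1, h2⟩)
      · exact ⟨Or.inl (by linarith), by linarith, by linarith⟩
      · exact ⟨Or.inr (by linarith), by linarith, by linarith⟩
  have hl : IntervalIntegrable f volume (x - R) (x - ε) := by
    apply ContinuousOn.intervalIntegrable
    apply hf.mono
    rw [Set.uIcc_of_le (by linarith)]
    rintro y ⟨_, h2⟩ (rfl : y = x)
    linarith
  have hr : IntervalIntegrable f volume (x + ε) (x + R) := by
    apply ContinuousOn.intervalIntegrable
    apply hf.mono
    rw [Set.uIcc_of_le (by linarith)]
    rintro y ⟨h1, _⟩ (rfl : y = x)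
    linarith
  have hd : Disjoint (Set.Ioo (x - R) (x - ε)) (Set.Ioo (x + ε) (x + R)) := by
    rw [Set.disjoint_left]
    rintro y ⟨_, h1⟩ ⟨h2, _⟩
    linarith
  have h1 : IntegrableOn f (Set.Ioo (x - R) (x - ε)) :=
    ((intervalIntegrable_iff_integrableOn_Ioc_of_le (by linarith)).1 hl).mono_set
      Set.Ioo_subset_Ioc_self
  have h2 : IntegrableOn f (Set.Ioo (x + ε) (x + R)) :=
    ((intervalIntegrable_iff_integrableOn_Ioc_of_le (by linarith)).1 hr).mono_set
      Set.Ioo_subset_Ioc_self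
  rw [hset, setIntegral_union hd measurableSet_Ioo h1 h2, ← integral_Ioc_eq_integral_Ioo,
    ← integral_Ioc_eq_integral_Ioo, ← intervalIntegral.integral_of_le (by linarith),
    ← intervalIntegral.integral_of_le (by linarith), intervalIntegral.integral_add,
    intervalIntegral.integral_comp_add_left, intervalIntegral.integral_comp_sub_left, add_comm]
  · have := hr.comp_add_left x
    simpa using this
  · have := (hl.comp_sub_left x).symm
    simpa using this

theorem integrableOn_annulus {f : ℝ → ℝ} {x : ℝ} (hf : ContinuousOn f {x}ᶜ) {ε : ℝ} (hε : 0 < ε)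
    (R : ℝ) : IntegrableOn f {y | ε < |x - y| ∧ |x - y| < R} := by
  have hK : IsCompact (Metric.closedBall x R ∩ {y | ε ≤ |x - y|}) :=
    (isCompact_closedBall x R).inter_right (isClosed_le (by fun_prop) (by fun_prop))
  refine (ContinuousOn.integrableOn_compact hK (hf.mono ?_)).mono_set ?_
  · rintro y ⟨_, h⟩ (rfl : y = x)
    simp at h
    linarith
  · rintro y ⟨h1, h2⟩
    refine ⟨?_, h1.le⟩
    rw [Metric.mem_closedBall, dist_comm, Real.dist_eq]
    exact h2.le

/-- Eventually, the radii of a truncation are positive and correctly ordered. -/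
theorem eventually_pos_le :
    ∀ᶠ p : ℝ × ℝ in 𝓝[>] 0 ×ˢ atTop, 0 < p.1 ∧ p.1 ≤ p.2 := by
  have h : ∀ᶠ ε : ℝ in 𝓝[>] 0, 0 < ε ∧ ε ≤ 1 := by
    filter_upwards [Ioc_mem_nhdsGT (show (0 : ℝ) < 1 by norm_num)] with ε h using h
  filter_upwards [h.prod_mk (eventually_ge_atTop (1 : ℝ))] with p hp
  exact ⟨hp.1.1, hp.1.2.trans hp.2⟩

/-- The principal value of a function continuous off `x` is the limit of its symmetrised
integrals. -/
theorem hasPrincipalValue_iff {f : ℝ → ℝ} {x v : ℝ} (hf : ContinuousOn f {x}ᶜ) :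
    HasPrincipalValue f x v ↔
      Tendsto (fun p : ℝ × ℝ => ∫ r in p.1..p.2, (f (x + r) + f (x - r)))
        (𝓝[>] 0 ×ˢ atTop) (𝓝 v) := by
  have hev : (fun p : ℝ × ℝ => ∫ y in {y | p.1 < |x - y| ∧ |x - y| < p.2}, f y)
      =ᶠ[𝓝[>] 0 ×ˢ atTop] fun p => ∫ r in p.1..p.2, (f (x + r) + f (x - r)) := by
    filter_upwards [eventually_pos_le] with p hp
    exact integral_annulus hf hp.1 hp.2
  unfold HasPrincipalValue
  rw [tendsto_congr' hev]
  exact and_iff_right fun ε R hε => integrableOn_annulus hf hε R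

/-! ### Contour integrals over half annuli -/

/-- The closed upper half plane. -/
def upper : Set ℂ := {z | 0 ≤ z.im}

theorem ofReal_mem_upper (x : ℝ) : (x : ℂ) ∈ upper := by simp [upper]

/-- The integral of `g` over the upper half circle of radius `r` about `x`, up to a factor `i`. -/
def arc (g : ℂ → ℂ) (x r : ℝ) : ℂ :=
  ∫ θ in (0 : ℝ)..Real.pi,
    r * Complex.exp (θ * Complex.I) * g (x + r * Complex.exp (θ * Complex.I))

theorem add_arc_mem_upper (x : ℝ) {r θ : ℝ} (hr : 0 < r) (hθ : θ ∈ Set.Icc 0 Real.pi) :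
    (x + r * Complex.exp (θ * Complex.I) : ℂ) ∈ upper := by
  have : 0 ≤ r * Real.sin θ := mul_nonneg hr.le (Real.sin_nonneg_of_mem_Icc hθ)
  simpa [upper, Complex.exp_ofReal_mul_I_im] using this

theorem norm_arc_point {r : ℝ} (hr : 0 < r) (θ : ℝ) :
    ‖(r * Complex.exp (θ * Complex.I) : ℂ)‖ = r := by
  simp [Complex.norm_exp_ofReal_mul_I, hr.le]

theorem norm_arc_le {g : ℂ → ℂ} {x r M : ℝ} (hr : 0 < r)
    (h : ∀ z ∈ upper, ‖z - x‖ = r → ‖(z - x) * g z‖ ≤ M) : ‖arc g x r‖ ≤ M * Real.pi := by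
  have := intervalIntegral.norm_integral_le_of_norm_le_const (a := 0) (b := Real.pi) (C := M)
    (f := fun θ : ℝ => r * Complex.exp (θ * Complex.I) *
      g (x + r * Complex.exp (θ * Complex.I))) ?_
  · simpa [arc, abs_of_pos Real.pi_pos] using this
  · intro θ hθ
    rw [Set.uIoc_of_le Real.pi_pos.le] at hθ
    have := h _ (add_arc_mem_upper x hr ⟨hθ.1.le, hθ.2⟩)
      (by rw [add_sub_cancel_left]; exact norm_arc_point hr θ)
    simpa using this

/-- Cauchy's theorem on the upper half annulus `ε ≤ |z - x| ≤ R`. In the coordinate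
`w = log (z - x)` the half annulus is the rectangle `[log ε, log R] × [0, π]`. -/
theorem integral_half_annulus {g : ℂ → ℂ} {x : ℝ} (hc : ContinuousOn g (upper \ {(x : ℂ)}))
    (hd : ∀ z : ℂ, 0 < z.im → DifferentiableAt ℂ g z) {ε R : ℝ} (hε : 0 < ε) (hR : ε ≤ R) :
    ∫ r in ε..R, (g ↑(x + r) + g ↑(x - r)) = Complex.I * (arc g x ε - arc g x R) := by
  have hR0 : 0 < R := hε.trans_le hR
  have hle : Real.log ε ≤ Real.log R := Real.log_le_log hε hR
  set f : ℂ → ℂ := fun w => Complex.exp w * g (x + Complex.exp w) with hf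
  have key := Complex.integral_boundary_rect_eq_zero_of_continuousOn_of_differentiableOn f
    (Real.log ε : ℂ) (Real.log R + Real.pi * Complex.I) ?_ ?_
  · -- the lower and the upper side of the rectangle are the two halves of the real annulus
    have e1 : ∫ t in (Real.log ε)..(Real.log R), f t = ∫ r in ε..R, g ↑(x + r) := by
      have := intervalIntegral.integral_deriv_smul_comp'' (a := Real.log ε) (b := Real.log R)
        (f := Real.exp) (f' := Real.exp) (g := fun r : ℝ => g ↑(x + r))
        Real.continuous_exp.continuousOn
        (fun t _ => (Real.hasDerivAt_exp t).hasDerivWithinAt) Real.continuous_exp.continuousOn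
        (hc.comp (by fun_prop) ?_)
      · rw [Real.exp_log hε, Real.exp_log hR0] at this
        rw [← this]
        refine intervalIntegral.integral_congr fun t _ => ?_
        simp [hf]
      · rintro _ ⟨t, _, rfl⟩
        refine ⟨ofReal_mem_upper _, ?_⟩
        simp only [Set.mem_singleton_iff, Complex.ofReal_inj]
        have := Real.exp_pos t
        linarith
    have e2 : ∫ t in (Real.log ε)..(Real.log R), f (t + Real.pi * Complex.I) =
        -∫ r in ε..R, g ↑(x - r) := by
      have := intervalIntegral.integral_deriv_smul_comp'' (a := Real.log ε) (b := Real.log R)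
        (f := Real.exp) (f' := Real.exp) (g := fun r : ℝ => g ↑(x - r))
        Real.continuous_exp.continuousOn
        (fun t _ => (Real.hasDerivAt_exp t).hasDerivWithinAt) Real.continuous_exp.continuousOn
        (hc.comp (by fun_prop) ?_)
      · rw [Real.exp_log hε, Real.exp_log hR0] at this
        rw [← this, ← intervalIntegral.integral_neg]
        refine intervalIntegral.integral_congr fun t _ => ?_
        simp [hf, Complex.exp_add, Complex.exp_pi_mul_I, sub_eq_add_neg]
      · rintro _ ⟨t, _, rfl⟩
        refine ⟨ofReal_mem_upper _, ?_⟩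
        simp only [Set.mem_singleton_iff, Complex.ofReal_inj]
        have := Real.exp_pos t
        linarith
    -- the vertical sides are the half circles
    have e3 : ∀ s : ℝ, 0 < s → ∫ θ in (0 : ℝ)..Real.pi, f (Real.log s + θ * Complex.I) =
        arc g x s := by
      intro s hs
      refine intervalIntegral.integral_congr fun θ _ => ?_
      simp [hf, Complex.exp_add, ← Complex.ofReal_exp, Real.exp_log hs]
    simp only [Complex.ofReal_re, Complex.ofReal_im, Complex.add_re, Complex.add_im,
      Complex.mul_re, Complex.mul_im, Complex.I_re, Complex.I_im, mul_zero, mul_one, sub_zero,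
      zero_add, add_zero, zero_mul, Complex.ofReal_zero, smul_eq_mul] at key
    rw [e1, e2, e3 _ hε, e3 _ hR0] at key
    rw [intervalIntegral.integral_add]
    · linear_combination key
    · apply ContinuousOn.intervalIntegrable
      refine hc.comp (by fun_prop) fun r hr => ⟨ofReal_mem_upper _, ?_⟩
      rw [Set.uIcc_of_le hR] at hr
      simp only [Set.mem_singleton_iff, Complex.ofReal_inj]
      linarith [hr.1]
    · apply ContinuousOn.intervalIntegrable
      refine hc.comp (by fun_prop) fun r hr => ⟨ofReal_mem_upper _, ?_⟩
      rw [Set.uIcc_of_le hR] at hr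
      simp only [Set.mem_singleton_iff, Complex.ofReal_inj]
      linarith [hr.1]
  -- `exp` maps the closed rectangle into the closed, and its interior into the open half plane
  · refine Continuous.continuousOn (by fun_prop) |>.mul (hc.comp (by fun_prop) ?_)
    rintro w ⟨_, hw⟩
    simp only [Complex.ofReal_im, Complex.add_im, Complex.mul_im, Complex.ofReal_re, Complex.I_im,
      Complex.I_re, mul_one, mul_zero, add_zero, zero_add, Set.mem_preimage,
      Set.uIcc_of_le Real.pi_pos.le] at hw
    refine ⟨?_, by simp⟩
    have : 0 ≤ Real.exp w.re * Real.sin w.im :=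
      mul_nonneg (Real.exp_pos _).le (Real.sin_nonneg_of_mem_Icc hw)
    simpa [upper, Complex.exp_im] using this
  · rintro w ⟨_, hw⟩
    simp only [Complex.ofReal_im, Complex.add_im, Complex.mul_im, Complex.ofReal_re, Complex.I_im,
      Complex.I_re, mul_one, mul_zero, add_zero, zero_add, Set.mem_preimage,
      min_eq_left Real.pi_pos.le, max_eq_right Real.pi_pos.le] at hw
    have him : 0 < (x + Complex.exp w : ℂ).im := by
      have : 0 < Real.exp w.re * Real.sin w.im :=
        mul_pos (Real.exp_pos _) (Real.sin_pos_of_mem_Ioo hw)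
      simpa [Complex.exp_im] using this
    have h2 : DifferentiableAt ℂ (fun w => g (x + Complex.exp w)) w :=
      DifferentiableAt.comp (g := g) w (hd _ him) (by fun_prop)
    exact (Complex.differentiable_exp.differentiableAt.mul h2).differentiableWithinAt

/-- Jordan-type lemma: `arc g x r` tends to `π A` along any filter of radii along which
`(z - x) g z` tends to `A` uniformly on the half circles. -/
theorem tendsto_arc {g : ℂ → ℂ} {x : ℝ} (hc : ContinuousOn g (upper \ {(x : ℂ)})) {A : ℂ}
    {l : Filter ℝ} {k : Filter ℂ} (hl : ∀ᶠ r in l, 0 < r)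
    (hk : k = (comap (fun z : ℂ => ‖z - x‖) l) ⊓ 𝓟 upper)
    (h : Tendsto (fun z => (z - x) * g z) k (𝓝 A)) :
    Tendsto (arc g x) l (𝓝 (Real.pi * A)) := by
  rw [Metric.tendsto_nhds] at h ⊢
  intro δ hδ
  have h1 := h (δ / 4) (by positivity)
  rw [hk, eventually_inf_principal, eventually_comap] at h1
  filter_upwards [h1, hl] with r hr hr0
  have hint : IntervalIntegrable (fun θ : ℝ => r * Complex.exp (θ * Complex.I) *
      g (x + r * Complex.exp (θ * Complex.I))) volume 0 Real.pi := by
    apply ContinuousOn.intervalIntegrable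
    refine (Continuous.continuousOn (by fun_prop)).mul (hc.comp (by fun_prop) fun θ hθ => ?_)
    rw [Set.uIcc_of_le Real.pi_pos.le] at hθ
    exact ⟨add_arc_mem_upper x hr0 hθ, by simp [hr0.ne']⟩
  have e : arc g x r - Real.pi * A = ∫ θ in (0 : ℝ)..Real.pi,
      (r * Complex.exp (θ * Complex.I) * g (x + r * Complex.exp (θ * Complex.I)) - A) := by
    rw [intervalIntegral.integral_sub hint (by simp)]
    simp [arc]
  rw [dist_eq_norm, e]
  have := intervalIntegral.norm_integral_le_of_norm_le_const (a := 0) (b := Real.pi) (C := δ / 4)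
    (f := fun θ : ℝ => r * Complex.exp (θ * Complex.I) *
      g (x + r * Complex.exp (θ * Complex.I)) - A) ?_
  · refine this.trans_lt ?_
    rw [sub_zero, abs_of_pos Real.pi_pos]
    nlinarith [Real.pi_lt_four]
  · intro θ hθ
    rw [Set.uIoc_of_le Real.pi_pos.le] at hθ
    have := hr (x + r * Complex.exp (θ * Complex.I))
      (by rw [add_sub_cancel_left]; exact norm_arc_point hr0 θ)
      (add_arc_mem_upper x hr0 ⟨hθ.1.le, hθ.2⟩)
    rw [dist_eq_norm, add_sub_cancel_left] at this
    exact this.le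

/-- If `g` is holomorphic in the upper half plane and continuous up to the real line off `x`, then
the principal value of `∫ g` over the real line is `iπ(A - B)`, where `A` and `B` are the limits
of `(z - x) g z` at `x` and at infinity. -/
theorem tendsto_integral_boundary {g : ℂ → ℂ} {x : ℝ}
    (hc : ContinuousOn g (upper \ {(x : ℂ)})) (hd : ∀ z : ℂ, 0 < z.im → DifferentiableAt ℂ g z)
    {A B : ℂ} (hA : Tendsto (fun z => (z - x) * g z) (𝓝[upper \ {(x : ℂ)}] x) (𝓝 A))
    (hB : Tendsto (fun z => (z - x) * g z) (Bornology.cobounded ℂ ⊓ 𝓟 upper) (𝓝 B)) :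
    Tendsto (fun p : ℝ × ℝ => ∫ r in p.1..p.2, (g ↑(x + r) + g ↑(x - r)))
      (𝓝[>] 0 ×ˢ atTop) (𝓝 (Complex.I * Real.pi * (A - B))) := by
  have h0 : Tendsto (arc g x) (𝓝[>] 0) (𝓝 (Real.pi * A)) := by
    have hk : 𝓝[upper \ {(x : ℂ)}] (x : ℂ) =
        comap (fun z : ℂ => ‖z - x‖) (𝓝[>] 0) ⊓ 𝓟 upper := by
      rw [nhdsWithin, nhdsWithin, comap_inf, comap_principal, Set.sdiff_eq,
        show (fun z : ℂ => ‖z - x‖) = fun z => dist z (x : ℂ) from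
          funext fun z => (dist_eq_norm z _).symm, nhds_comap_dist, inf_assoc, inf_principal,
        Set.inter_comm]
      congr 3
      ext z
      simp [dist_pos]
    exact tendsto_arc hc self_mem_nhdsWithin hk hA
  have h1 : Tendsto (arc g x) atTop (𝓝 (Real.pi * B)) := by
    have hk : Bornology.cobounded ℂ ⊓ 𝓟 upper =
        comap (fun z : ℂ => ‖z - x‖) atTop ⊓ 𝓟 upper := by
      rw [show (fun z : ℂ => ‖z - x‖) = fun z => dist z (x : ℂ) from
          funext fun z => (dist_eq_norm z _).symm, Metric.comap_dist_right_atTop]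
    exact tendsto_arc hc (eventually_gt_atTop 0) hk hB
  have h2 : Tendsto (fun p : ℝ × ℝ => Complex.I * (arc g x p.1 - arc g x p.2))
      (𝓝[>] 0 ×ˢ atTop) (𝓝 (Complex.I * (Real.pi * A - Real.pi * B))) :=
    ((h0.comp tendsto_fst).sub (h1.comp tendsto_snd)).const_mul _
  rw [show Complex.I * Real.pi * (A - B) = Complex.I * (Real.pi * A - Real.pi * B) by ring]
  refine h2.congr' ?_
  filter_upwards [eventually_pos_le] with p hp
  exact (integral_half_annulus hc hd hp.1 hp.2).symm

theorem integral_clm_boundary {g : ℂ → ℂ} {x : ℝ} (hc : ContinuousOn g (upper \ {(x : ℂ)}))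
    (L : ℂ →L[ℝ] ℝ) {ε R : ℝ} (hε : 0 < ε) (hR : ε ≤ R) :
    ∫ r in ε..R, (L (g ↑(x + r)) + L (g ↑(x - r))) =
      L (∫ r in ε..R, (g ↑(x + r) + g ↑(x - r))) := by
  simp only [← map_add]
  rw [ContinuousLinearMap.intervalIntegral_comp_comm]
  have hr : ∀ r ∈ Set.uIcc ε R, r ≠ 0 := fun r hr => by
    rw [Set.uIcc_of_le hR] at hr
    exact (hε.trans_le hr.1).ne'
  apply ContinuousOn.intervalIntegrable
  apply ContinuousOn.add
  · exact hc.comp (by fun_prop) fun r h => ⟨ofReal_mem_upper _, by simp [hr r h]⟩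
  · exact hc.comp (by fun_prop) fun r h => ⟨ofReal_mem_upper _, by simp [hr r h]⟩

/-- The principal value over the real line of a real-linear functional of the boundary values of a
function holomorphic in the upper half plane. -/
theorem hasPrincipalValue_boundary {g : ℂ → ℂ} {x : ℝ}
    (hc : ContinuousOn g (upper \ {(x : ℂ)})) (hd : ∀ z : ℂ, 0 < z.im → DifferentiableAt ℂ g z)
    {A B : ℂ} (hA : Tendsto (fun z => (z - x) * g z) (𝓝[upper \ {(x : ℂ)}] x) (𝓝 A))
    (hB : Tendsto (fun z => (z - x) * g z) (Bornology.cobounded ℂ ⊓ 𝓟 upper) (𝓝 B))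
    (L : ℂ →L[ℝ] ℝ) :
    HasPrincipalValue (fun y : ℝ => L (g y)) x (L (Complex.I * Real.pi * (A - B))) := by
  have hcr : ContinuousOn (fun y : ℝ => g y) {x}ᶜ :=
    hc.comp Complex.continuous_ofReal.continuousOn
      fun y hy => ⟨ofReal_mem_upper y, by simpa using hy⟩
  rw [hasPrincipalValue_iff (f := fun y : ℝ => L (g y)) (L.continuous.comp_continuousOn hcr)]
  refine ((L.continuous.tendsto _).comp (tendsto_integral_boundary hc hd hA hB)).congr' ?_
  filter_upwards [eventually_pos_le] with p hp
  exact (integral_clm_boundary hc L hp.1 hp.2).symm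

/-! ### Bounded holomorphic functions with two square-root branch points on the real line -/

/-- `F` is a function bounded by `1` on the closed upper half plane, holomorphic inside, with
limit `c` at infinity, whose boundary function has derivative `F'` off the two points `a`, `b`;
the difference quotients at the real line blow up at most like an inverse square root there. -/
structure IsBranched (F : ℂ → ℂ) (F' : ℝ → ℂ) (a b c C : ℝ) : Prop where
  continuousOn : ContinuousOn F upper
  differentiableAt : ∀ z : ℂ, 0 < z.im → DifferentiableAt ℂ F z
  tendsto : Tendsto F (Bornology.cobounded ℂ ⊓ 𝓟 upper) (𝓝 c)
  norm_le : ∀ z ∈ upper, ‖F z‖ ≤ 1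
  hasDerivWithinAt : ∀ x : ℝ, x ≠ a → x ≠ b → HasDerivWithinAt F (F' x) upper x
  const_nonneg : 0 ≤ C
  norm_sub_le : ∀ x : ℝ, x ≠ a → x ≠ b → ∀ z ∈ upper,
    ‖F z - F x‖ ≤ C * ((√|x - a|)⁻¹ + (√|x - b|)⁻¹) * ‖z - x‖

theorem fracLaplacianConst_half : fracLaplacianConst (1 / 2) = 1 / Real.pi := by
  have h2 : Real.Gamma (-(1 / 2)) = -(2 * √Real.pi) := by
    have h := Real.Gamma_add_one (s := -(1 / 2)) (by norm_num)
    rw [show (-(1 / 2) + 1 : ℝ) = 1 / 2 by norm_num, Real.Gamma_one_half_eq] at h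
    linarith
  have h4 : (4 : ℝ) ^ (1 / 2 : ℝ) = 2 := by
    rw [← Real.sqrt_eq_rpow, show (4 : ℝ) = 2 ^ 2 by norm_num, Real.sqrt_sq (by norm_num)]
  have hπ : 0 < √Real.pi := Real.sqrt_pos.2 Real.pi_pos
  rw [fracLaplacianConst, h2, h4, show (1 / 2 + 1 / 2 : ℝ) = 1 by norm_num, Real.Gamma_one,
    ← Real.sqrt_eq_rpow, abs_neg, abs_of_pos (by positivity)]
  have : √Real.pi * √Real.pi = Real.pi := Real.mul_self_sqrt Real.pi_pos.le
  rw [show √Real.pi * (2 * √Real.pi) = 2 * Real.pi by linear_combination 2 * this]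
  field_simp

theorem abs_sub_rpow_two (x y : ℝ) : |x - y| ^ (1 + 2 * (1 / 2) : ℝ) = (x - y) ^ 2 := by
  rw [show (1 + 2 * (1 / 2) : ℝ) = (2 : ℕ) by norm_num, Real.rpow_natCast, sq_abs]

theorem tendsto_inv_sub_cobounded (x : ℂ) :
    Tendsto (fun z : ℂ => (z - x)⁻¹) (Bornology.cobounded ℂ ⊓ 𝓟 upper) (𝓝 0) := by
  exact (tendsto_inv₀_cobounded.comp (tendsto_sub_const_cobounded x)).mono_left inf_le_left

namespace IsBranched

variable {F : ℂ → ℂ} {F' : ℝ → ℂ} {a b c C : ℝ}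

theorem continuous_ofReal (h : IsBranched F F' a b c C) : Continuous fun y : ℝ => F y :=
  h.continuousOn.comp_continuous Complex.continuous_ofReal ofReal_mem_upper

/-- The Hilbert transform of a boundary function with limit `c` at infinity is `-i (F - c)`. -/
theorem hasHilbertAt (h : IsBranched F F' a b c C) (L : ℂ →L[ℝ] ℝ) (x : ℝ) :
    HasHilbertAt (fun y => L (F y)) x (L (-Complex.I * (F x - c))) := by
  have hc : ContinuousOn (fun z => F z / (x - z)) (upper \ {(x : ℂ)}) := by
    refine (h.continuousOn.mono Set.sdiff_subset).div (by fun_prop) fun z hz => ?_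
    rw [sub_ne_zero]
    exact fun e => hz.2 e.symm
  have hd : ∀ z : ℂ, 0 < z.im → DifferentiableAt ℂ (fun z => F z / (x - z)) z := by
    intro z hz
    refine (h.differentiableAt z hz).div (by fun_prop) ?_
    rw [sub_ne_zero]
    rintro rfl
    simp at hz
  have hmul : ∀ z : ℂ, z ≠ x → (z - x) * (F z / (x - z)) = -F z := by
    intro z hz
    have : (x - z : ℂ) ≠ 0 := sub_ne_zero.2 hz.symm
    field_simp
    ring
  have hA : Tendsto (fun z => (z - x) * (F z / (x - z))) (𝓝[upper \ {(x : ℂ)}] x) (𝓝 (-F x)) := by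
    refine (((h.continuousOn x (ofReal_mem_upper x)).tendsto.mono_left
      (nhdsWithin_mono _ Set.sdiff_subset)).neg).congr' ?_
    filter_upwards [self_mem_nhdsWithin] with z hz using (hmul z hz.2).symm
  have hB : Tendsto (fun z => (z - x) * (F z / (x - z))) (Bornology.cobounded ℂ ⊓ 𝓟 upper)
      (𝓝 (-c)) := by
    refine h.tendsto.neg.congr' ?_
    filter_upwards [mem_inf_of_left (Metric.hasBasis_cobounded_compl_closedBall (x : ℂ) |>.mem_of_mem
      (i := 0) trivial)] with z hz
    refine (hmul z fun e => ?_).symm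
    simp [e] at hz
  have key := hasPrincipalValue_boundary hc hd hA hB L
  refine ⟨L (Complex.I * Real.pi * (-F x - -c)), ?_, ?_⟩
  · convert key using 2 with y
    rw [show F y / ((x : ℂ) - y) = (x - y)⁻¹ • F y by
      rw [Complex.real_smul]; push_cast; rw [div_eq_mul_inv, mul_comm], map_smul, smul_eq_mul,
      div_eq_mul_inv, mul_comm]
  · rw [show Complex.I * Real.pi * (-F x - -c) = Real.pi • (-Complex.I * (F x - c)) by
      rw [Complex.real_smul]; ring, map_smul, smul_eq_mul]
    field_simp

theorem quotient_continuousOn (h : IsBranched F F' a b c C) (x : ℝ) :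
    ContinuousOn (fun z => (F x - F z) / (x - z) ^ 2) (upper \ {(x : ℂ)}) := by
  refine (continuousOn_const.sub (h.continuousOn.mono Set.sdiff_subset)).div (by fun_prop)
    fun z hz => ?_
  rw [pow_ne_zero_iff two_ne_zero, sub_ne_zero]
  exact fun e => hz.2 e.symm

theorem quotient_differentiableAt (h : IsBranched F F' a b c C) (x : ℝ) (z : ℂ) (hz : 0 < z.im) :
    DifferentiableAt ℂ (fun z => (F x - F z) / (x - z) ^ 2) z := by
  refine ((differentiableAt_const _).sub (h.differentiableAt z hz)).div (by fun_prop) ?_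
  rw [pow_ne_zero_iff two_ne_zero, sub_ne_zero]
  rintro rfl
  simp at hz

theorem quotient_ofReal (L : ℂ →L[ℝ] ℝ) (x y : ℝ) :
    L ((F x - F y) / ((x : ℂ) - y) ^ 2) = (L (F x) - L (F y)) / (x - y) ^ 2 := by
  rw [show (F x - F y) / ((x : ℂ) - y) ^ 2 = ((x - y) ^ 2)⁻¹ • (F x - F y) by
    rw [Complex.real_smul]; push_cast; rw [div_eq_mul_inv, mul_comm], map_smul, smul_eq_mul,
    map_sub, div_eq_mul_inv, mul_comm]

/-- The square root of the Laplacian of a boundary function is `-i F'`. -/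
theorem hasFracLaplacianAt (h : IsBranched F F' a b c C) (L : ℂ →L[ℝ] ℝ) {x : ℝ}
    (ha : x ≠ a) (hb : x ≠ b) :
    HasFracLaplacianAt (1 / 2) (fun y => L (F y)) x (L (-Complex.I * F' x)) := by
  have hA : Tendsto (fun z => (z - x) * ((F x - F z) / (x - z) ^ 2)) (𝓝[upper \ {(x : ℂ)}] x)
      (𝓝 (-F' x)) := by
    have := hasDerivWithinAt_iff_tendsto_slope.1 (h.hasDerivWithinAt x ha hb)
    refine this.neg.congr' ?_
    filter_upwards [self_mem_nhdsWithin] with z hz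
    have : (x - z : ℂ) ≠ 0 := sub_ne_zero.2 (Ne.symm hz.2)
    have h2 : (z - x : ℂ) ≠ 0 := sub_ne_zero.2 hz.2
    rw [slope_def_field]
    field_simp
    ring
  have hB : Tendsto (fun z => (z - x) * ((F x - F z) / (x - z) ^ 2))
      (Bornology.cobounded ℂ ⊓ 𝓟 upper) (𝓝 0) := by
    have h0 := (tendsto_inv_sub_cobounded x).mul (h.tendsto.const_sub (F x))
    rw [zero_mul] at h0
    refine h0.congr fun z => ?_
    rcases eq_or_ne z x with rfl | hz
    · simp
    have h2 : (z - x : ℂ) ≠ 0 := sub_ne_zero.2 hz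
    rw [show (x - z : ℂ) ^ 2 = (z - x) ^ 2 by ring]
    field_simp
  have key := hasPrincipalValue_boundary (h.quotient_continuousOn x)
    (h.quotient_differentiableAt x) hA hB L
  refine ⟨L (Complex.I * Real.pi * (-F' x - 0)), ?_, ?_⟩
  · convert key using 2 with y
    rw [quotient_ofReal, abs_sub_rpow_two]
  · rw [fracLaplacianConst_half, show Complex.I * Real.pi * (-F' x - 0) =
      Real.pi • (-Complex.I * F' x) by rw [Complex.real_smul]; ring, map_smul, smul_eq_mul]
    field_simp

theorem hasDerivAt_ofReal (h : IsBranched F F' a b c C) {x : ℝ} (ha : x ≠ a) (hb : x ≠ b) :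
    HasDerivAt (fun y : ℝ => F y) (F' x) x := by
  have := (h.hasDerivWithinAt x ha hb).scomp_hasDerivAt x Complex.ofRealCLM.hasDerivAt
    ofReal_mem_upper
  rw [Complex.ofRealCLM_apply, Complex.ofReal_one, one_smul] at this
  exact this

theorem hasDerivAt (h : IsBranched F F' a b c C) (L : ℂ →L[ℝ] ℝ) {x : ℝ}
    (ha : x ≠ a) (hb : x ≠ b) : HasDerivAt (fun y : ℝ => L (F y)) (L (F' x)) x :=
  L.hasFDerivAt.comp_hasDerivAt x (h.hasDerivAt_ofReal ha hb)

end IsBranched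

/-! ### Second differences and the square root of the Laplacian of a test function -/

/-- The second difference quotient of `u` at `x` with step `t`, signed as in `(-Δ)^(1/2)`. -/
def secondQuot (u : ℝ → ℝ) (x t : ℝ) : ℝ := (2 * u x - u (x + t) - u (x - t)) / t ^ 2

theorem fold_eq_secondQuot (u : ℝ → ℝ) (x r : ℝ) :
    (u x - u (x + r)) / (x - (x + r)) ^ 2 + (u x - u (x - r)) / (x - (x - r)) ^ 2 =
      secondQuot u x r := by
  rw [secondQuot, show x - (x + r) = -r by ring, show x - (x - r) = r by ring, neg_sq, ← add_div]
  ring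

theorem hasPrincipalValue_iff_secondQuot {u : ℝ → ℝ} (hu : Continuous u) {x v : ℝ} :
    HasPrincipalValue (fun y => (u x - u y) / |x - y| ^ (1 + 2 * (1 / 2) : ℝ)) x v ↔
      Tendsto (fun p : ℝ × ℝ => ∫ r in p.1..p.2, secondQuot u x r)
        (𝓝[>] 0 ×ˢ atTop) (𝓝 v) := by
  simp only [abs_sub_rpow_two]
  rw [hasPrincipalValue_iff]
  · simp only [fold_eq_secondQuot]
  · refine ContinuousOn.div (by fun_prop) (by fun_prop) fun y hy => ?_
    rw [pow_ne_zero_iff two_ne_zero, sub_ne_zero]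
    exact fun e => hy e.symm

theorem tendsto_integral_Ioi {f : ℝ → ℝ} (hf : IntegrableOn f (Set.Ioi 0)) :
    Tendsto (fun p : ℝ × ℝ => ∫ r in p.1..p.2, f r) (𝓝[>] 0 ×ˢ atTop)
      (𝓝 (∫ r in Set.Ioi 0, f r)) := by
  set f₀ := (Set.Ioi (0 : ℝ)).indicator f
  have hf₀ : Integrable f₀ := hf.integrable_indicator measurableSet_Ioi
  have h1 : Tendsto (fun ε : ℝ => ∫ r in (0 : ℝ)..ε, f₀ r) (𝓝[>] 0) (𝓝 0) := by
    have := (intervalIntegral.continuous_primitive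
      (fun a b => hf₀.intervalIntegrable (a := a) (b := b)) 0).tendsto 0
    rw [intervalIntegral.integral_same] at this
    exact this.mono_left nhdsWithin_le_nhds
  have h2 : Tendsto (fun R : ℝ => ∫ r in (0 : ℝ)..R, f₀ r) atTop
      (𝓝 (∫ r in Set.Ioi 0, f₀ r)) :=
    intervalIntegral_tendsto_integral_Ioi 0 hf₀.integrableOn tendsto_id
  have h3 : ∫ r in Set.Ioi 0, f₀ r = ∫ r in Set.Ioi 0, f r :=
    setIntegral_congr_fun measurableSet_Ioi fun r hr => Set.indicator_of_mem hr f
  rw [h3] at h2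
  have h4 := (h2.comp tendsto_snd).sub (h1.comp (tendsto_fst (g := (atTop : Filter ℝ))))
  rw [sub_zero] at h4
  refine h4.congr' ?_
  filter_upwards [eventually_pos_le] with p hp
  simp only [Function.comp_apply]
  rw [intervalIntegral.integral_interval_sub_left hf₀.intervalIntegrable hf₀.intervalIntegrable]
  refine intervalIntegral.integral_congr fun r hr => ?_
  rw [Set.uIcc_of_le hp.2] at hr
  exact Set.indicator_of_mem (show r ∈ Set.Ioi (0 : ℝ) from hp.1.trans_le hr.1) f

theorem _root_.SchwartzMap.exists_abs_le_div (φ : 𝓢(ℝ, ℝ)) :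
    ∃ C, 0 ≤ C ∧ ∀ x, |φ x| ≤ C / (1 + x ^ 2) := by
  obtain ⟨C₀, h₀, hC₀⟩ := φ.decay 0 0
  obtain ⟨C₂, h₂, hC₂⟩ := φ.decay 2 0
  refine ⟨C₀ + C₂, by positivity, fun x => ?_⟩
  have h1 := hC₀ x
  have h2 := hC₂ x
  simp only [pow_zero, one_mul, norm_iteratedFDeriv_zero, Real.norm_eq_abs, sq_abs] at h1 h2
  rw [le_div_iff₀ (by positivity)]
  linarith

/-- Near `t = 0` the second difference quotients of a test function are bounded by an integrable
function of `x`, uniformly in `t`. -/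
theorem exists_abs_secondQuot_le (φ : 𝓢(ℝ, ℝ)) :
    ∃ C, 0 ≤ C ∧ ∀ x t, 0 < t → t ≤ 1 → |secondQuot φ x t| ≤ C * (1 + x ^ 2)⁻¹ := by
  set φ₁ := SchwartzMap.derivCLM ℝ ℝ φ
  set φ₂ := SchwartzMap.derivCLM ℝ ℝ φ₁
  have hd1 : ∀ y, HasDerivAt φ (φ₁ y) y := fun y => φ.differentiableAt.hasDerivAt
  have hd2 : ∀ y, HasDerivAt φ₁ (φ₂ y) y := fun y => φ₁.differentiableAt.hasDerivAt
  obtain ⟨C, hC, h⟩ := φ₂.exists_abs_le_div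
  refine ⟨2 * (3 * C), by positivity, fun x t ht ht1 => ?_⟩
  -- two applications of the mean value theorem
  obtain ⟨s, hs, hs'⟩ := exists_hasDerivAt_eq_slope (fun t => φ (x + t) + φ (x - t))
    (fun t => φ₁ (x + t) - φ₁ (x - t)) ht
    (((φ.continuous.comp (by fun_prop : Continuous fun t : ℝ => x + t)).add
      (φ.continuous.comp (by fun_prop : Continuous fun t : ℝ => x - t))).continuousOn)
    (fun y _ => ((hd1 (x + y)).comp_const_add x y).add ((hd1 (x - y)).comp_const_sub x y))
  obtain ⟨ξ, hξ, hξ'⟩ := exists_hasDerivAt_eq_slope φ₁ φ₂ (show x - s < x + s by linarith [hs.1])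
    φ₁.continuous.continuousOn (fun y _ => hd2 y)
  have hs0 : 0 < s := hs.1
  have hst : s < t := hs.2
  have e1 : φ₁ (x + s) - φ₁ (x - s) = 2 * s * φ₂ ξ := by
    rw [hξ', show x + s - (x - s) = 2 * s by ring]
    field_simp
  have e2 : secondQuot φ x t = -(2 * (s / t) * φ₂ ξ) := by
    rw [e1] at hs'
    simp only [add_zero, sub_zero] at hs'
    rw [eq_div_iff ht.ne'] at hs'
    rw [secondQuot]
    field_simp
    linear_combination hs'
  have hb : |φ₂ ξ| ≤ 3 * C * (1 + x ^ 2)⁻¹ := by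
    refine (h ξ).trans ?_
    rw [← div_eq_mul_inv, div_le_div_iff₀ (by positivity) (by positivity)]
    have h1 : |x - ξ| ≤ 1 := by
      rw [abs_le]
      constructor <;> linarith [hξ.1, hξ.2]
    have h2 : (x - ξ) ^ 2 ≤ 1 := by rw [← sq_abs]; exact pow_le_one₀ (abs_nonneg _) h1
    have : 1 + x ^ 2 ≤ 3 * (1 + ξ ^ 2) := by nlinarith [sq_nonneg (x - 2 * ξ)]
    nlinarith
  have hq : s / t ≤ 1 := (div_le_one ht).2 hst.le
  have hq0 : 0 ≤ s / t := by positivity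
  rw [e2, abs_neg, abs_mul, abs_mul, abs_of_nonneg hq0, abs_two]
  nlinarith [abs_nonneg (φ₂ ξ)]

theorem integrable_translate_add {f k : ℝ → ℝ} {ν : Measure ℝ} [SFinite ν]
    (hf : Integrable f) (hk : Integrable k ν) :
    Integrable (fun p : ℝ × ℝ => f (p.1 + p.2) * k p.2) (volume.prod ν) := by
  have h := hk.convolution_integrand (ContinuousLinearMap.mul ℝ ℝ) hf.comp_neg
  have hmp : MeasurePreserving (Prod.map (fun x : ℝ => -x) (fun t : ℝ => t))
      (volume.prod ν) (volume.prod ν) :=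
    (Measure.measurePreserving_neg volume).prod (MeasurePreserving.id ν)
  refine (hmp.integrable_comp_of_integrable h).congr (ae_of_all _ fun p => ?_)
  simp [mul_comm, add_comm]

theorem integrable_translate_sub {f k : ℝ → ℝ} {ν : Measure ℝ} [SFinite ν]
    (hf : Integrable f) (hk : Integrable k ν) :
    Integrable (fun p : ℝ × ℝ => f (p.1 - p.2) * k p.2) (volume.prod ν) := by
  refine (hk.convolution_integrand (ContinuousLinearMap.mul ℝ ℝ) hf).congr
    (ae_of_all _ fun p => ?_)
  simp [mul_comm]

theorem integrable_secondQuot_prod {f : ℝ → ℝ} {ν : Measure ℝ} [SFinite ν]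
    (hf : Integrable f) (hk : Integrable (fun t : ℝ => (t ^ 2)⁻¹) ν) :
    Integrable (fun p : ℝ × ℝ => secondQuot f p.1 p.2) (volume.prod ν) := by
  refine ((((hf.mul_prod hk).const_mul 2).sub (integrable_translate_add hf hk)).sub
    (integrable_translate_sub hf hk)).congr (ae_of_all _ fun p => ?_)
  simp only [Pi.sub_apply, secondQuot]
  ring

theorem integrableOn_inv_sq_Ioi {ε : ℝ} (hε : 0 < ε) :
    IntegrableOn (fun t : ℝ => (t ^ 2)⁻¹) (Set.Ioi ε) := by
  refine (integrableOn_Ioi_rpow_of_lt (a := -2) (by norm_num) hε).congr_fun (fun t ht => ?_)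
    measurableSet_Ioi
  have : 0 < t := hε.trans ht
  simp only [Real.rpow_neg this.le]
  norm_num

/-- The double integral defining the pairing with `(-Δ)^(1/2) φ` converges absolutely. -/
theorem _root_.SchwartzMap.integrable_secondQuot (φ : 𝓢(ℝ, ℝ)) :
    Integrable (fun p : ℝ × ℝ => secondQuot φ p.1 p.2)
      (volume.prod (volume.restrict (Set.Ioi 0))) := by
  have h1 : Integrable (fun p : ℝ × ℝ => secondQuot φ p.1 p.2)
      (volume.prod (volume.restrict (Set.Ioi 1))) :=
    integrable_secondQuot_prod φ.integrable (integrableOn_inv_sq_Ioi one_pos)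
  have h2 : Integrable (fun p : ℝ × ℝ => secondQuot φ p.1 p.2)
      (volume.prod (volume.restrict (Set.Ioc 0 1))) := by
    obtain ⟨C, hC, h⟩ := exists_abs_secondQuot_le φ
    refine Integrable.mono' (g := fun p : ℝ × ℝ => C * (1 + p.1 ^ 2)⁻¹ * 1)
      ((integrable_inv_one_add_sq.const_mul C).mul_prod (integrable_const 1)) ?_ ?_
    · have := φ.continuous
      refine Measurable.aestronglyMeasurable ?_
      unfold secondQuot
      fun_prop
    · have : ∀ᵐ t ∂(volume.restrict (Set.Ioc (0 : ℝ) 1)), t ∈ Set.Ioc (0 : ℝ) 1 :=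
        ae_restrict_mem measurableSet_Ioc
      filter_upwards [Measure.quasiMeasurePreserving_snd.ae this] with p hp
      rw [mul_one]
      exact h _ _ hp.1 hp.2
  rw [← Set.Ioc_union_Ioi_eq_Ioi (zero_le_one' ℝ),
    Measure.restrict_union (Set.Ioc_disjoint_Ioi le_rfl) measurableSet_Ioi, Measure.prod_add]
  exact h2.add_measure h1

theorem _root_.SchwartzMap.integrableOn_secondQuot (φ : 𝓢(ℝ, ℝ)) (x : ℝ) :
    IntegrableOn (secondQuot φ x) (Set.Ioi 0) := by
  have hm : Measurable (secondQuot φ x) := by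
    have := φ.continuous
    unfold secondQuot
    fun_prop
  rw [← Set.Ioc_union_Ioi_eq_Ioi (zero_le_one' ℝ)]
  refine IntegrableOn.union ?_ ?_
  · obtain ⟨C, hC, h⟩ := exists_abs_secondQuot_le φ
    refine Integrable.mono' (g := fun _ => C * (1 + x ^ 2)⁻¹) (integrable_const _)
      hm.aestronglyMeasurable ?_
    filter_upwards [ae_restrict_mem measurableSet_Ioc] with t ht
    exact h _ _ ht.1 ht.2
  · obtain ⟨C, hC, h⟩ := φ.exists_abs_le_div
    have hb : ∀ y, |φ y| ≤ C := fun y =>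
      (h y).trans (div_le_self hC (by linarith [sq_nonneg y]))
    refine Integrable.mono' (g := fun t => (4 * C) * (t ^ 2)⁻¹)
      ((integrableOn_inv_sq_Ioi one_pos).const_mul _) hm.aestronglyMeasurable
      (ae_of_all _ fun t => ?_)
    rw [secondQuot, Real.norm_eq_abs, abs_div, abs_of_nonneg (sq_nonneg t), div_eq_mul_inv]
    gcongr
    have := abs_le.1 (hb x)
    have := abs_le.1 (hb (x + t))
    have := abs_le.1 (hb (x - t))
    rw [abs_le]
    constructor <;> linarith

/-- `(-Δ)^(1/2) φ` for a test function `φ`. -/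
def sqrtLaplacian (φ : 𝓢(ℝ, ℝ)) (x : ℝ) : ℝ := 1 / Real.pi * ∫ t in Set.Ioi 0, secondQuot φ x t

theorem hasFracLaplacianAt_sqrtLaplacian (φ : 𝓢(ℝ, ℝ)) (x : ℝ) :
    HasFracLaplacianAt (1 / 2) φ x (sqrtLaplacian φ x) :=
  ⟨_, (hasPrincipalValue_iff_secondQuot φ.continuous).2
    (tendsto_integral_Ioi (φ.integrableOn_secondQuot x)), by
    rw [fracLaplacianConst_half, sqrtLaplacian]⟩

/-- The second difference operator is symmetric. -/
theorem integral_mul_secondQuot {u f : ℝ → ℝ} (hu : Continuous u) {B : ℝ} (hB : ∀ x, |u x| ≤ B)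
    (hf : Integrable f) (t : ℝ) :
    ∫ x, u x * secondQuot f x t = ∫ x, f x * secondQuot u x t := by
  have hbdd : ∀ {g : ℝ → ℝ}, Integrable g → ∀ s : ℝ, Integrable fun x => u (x + s) * g x := by
    intro g hg s
    exact hg.bdd_mul (c := B) (by fun_prop : Continuous fun x => u (x + s)).aestronglyMeasurable
      (ae_of_all _ fun x => hB _)
  have i0 : Integrable fun x => u x * f x := by simpa using hbdd hf 0
  have i1 : Integrable fun x => u x * f (x + t) := by simpa using hbdd (hf.comp_add_right t) 0
  have i2 : Integrable fun x => u x * f (x - t) := by simpa using hbdd (hf.comp_sub_right t) 0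
  have j1 := hbdd hf t
  have j2 : Integrable fun x => u (x - t) * f x := by simpa [sub_eq_add_neg] using hbdd hf (-t)
  have e1 : ∫ x, u x * f (x + t) = ∫ x, u (x - t) * f x := by
    rw [← integral_sub_right_eq_self (fun x => u x * f (x + t)) t]
    simp
  have e2 : ∫ x, u x * f (x - t) = ∫ x, u (x + t) * f x := by
    rw [← integral_add_right_eq_self (fun x => u x * f (x - t)) t]
    simp
  calc ∫ x, u x * secondQuot f x t
      = ∫ x, (2 * (u x * f x) - u x * f (x + t) - u x * f (x - t)) * (t ^ 2)⁻¹ := by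
        congr 1; ext x; rw [secondQuot]; ring
    _ = ∫ x, (2 * (u x * f x) - u (x + t) * f x - u (x - t) * f x) * (t ^ 2)⁻¹ := by
        rw [integral_mul_const, integral_mul_const, integral_sub _ i2, integral_sub _ i1,
          integral_sub _ j2, integral_sub _ j1, e1, e2]
        · ring
        · exact i0.const_mul 2
        · exact (i0.const_mul 2).sub j1
        · exact i0.const_mul 2
        · exact (i0.const_mul 2).sub i1
    _ = ∫ x, f x * secondQuot u x t := by
        congr 1; ext x; rw [secondQuot]; ring

/-- `(-Δ)^(1/2) u = g` weakly, provided that this holds pointwise almost everywhere and that the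
truncated singular integrals are dominated after multiplication with any test function. -/
theorem isFracLaplacian_of_dominated {u g M : ℝ → ℝ} (hu : Continuous u) {B : ℝ}
    (hB : ∀ x, |u x| ≤ B) (hpt : ∀ᵐ x, HasFracLaplacianAt (1 / 2) u x (g x))
    (hM : ∀ φ : 𝓢(ℝ, ℝ), Integrable fun x => M x * φ x)
    (hg : ∀ φ : 𝓢(ℝ, ℝ), Integrable fun x => g x * φ x)
    (hdom : ∀ᵐ x, ∀ ε R, 0 < ε → ε ≤ R → |∫ t in ε..R, secondQuot u x t| ≤ M x) :
    IsFracLaplacian (1 / 2) u g := by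
  intro φ
  have hK := φ.integrable_secondQuot
  have huK : Integrable (fun p : ℝ × ℝ => u p.1 * secondQuot φ p.1 p.2)
      (volume.prod (volume.restrict (Set.Ioi 0))) :=
    hK.bdd_mul (c := B) (hu.comp continuous_fst).aestronglyMeasurable (ae_of_all _ fun p => hB _)
  have hψ : Integrable fun x => u x * sqrtLaplacian φ x := by
    refine (huK.integral_prod_left.const_mul (1 / Real.pi)).congr (ae_of_all _ fun x => ?_)
    simp only [sqrtLaplacian, integral_const_mul]
    ring
  refine ⟨sqrtLaplacian φ, hasFracLaplacianAt_sqrtLaplacian φ, hg φ, hψ, ?_⟩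
  -- the truncated pairings, seen from the side of `φ`
  have hlim1 : Tendsto (fun p : ℝ × ℝ => ∫ t in p.1..p.2, ∫ x, u x * secondQuot φ x t)
      (𝓝[>] 0 ×ˢ atTop) (𝓝 (Real.pi * ∫ x, u x * sqrtLaplacian φ x)) := by
    have h := tendsto_integral_Ioi (f := fun t => ∫ x, u x * secondQuot φ x t)
      huK.integral_prod_right
    rw [← integral_integral_swap huK] at h
    convert h using 2
    rw [← integral_const_mul]
    congr 1
    ext x
    rw [sqrtLaplacian, integral_const_mul]
    field_simp
  -- and from the side of `u`
  have hlim2 : Tendsto (fun p : ℝ × ℝ => ∫ x, φ x * ∫ t in p.1..p.2, secondQuot u x t)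
      (𝓝[>] 0 ×ˢ atTop) (𝓝 (∫ x, φ x * (Real.pi * g x))) := by
    -- dominated convergence along the filter of truncations, by the bound `M`
    refine tendsto_integral_filter_of_dominated_convergence (fun x => ‖M x * φ x‖) ?_ ?_
      (hM φ).norm ?_
    · filter_upwards [eventually_pos_le] with p hp
      refine φ.continuous.aestronglyMeasurable.mul ?_
      simp only [intervalIntegral.integral_of_le hp.2]
      have : Measurable fun p : ℝ × ℝ => secondQuot u p.1 p.2 := by
        unfold secondQuot
        fun_prop
      exact this.stronglyMeasurable.integral_prod_right.aestronglyMeasurable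
    · filter_upwards [eventually_pos_le] with p hp
      filter_upwards [hdom] with x hx
      have h1 := hx p.1 p.2 hp.1 hp.2
      rw [norm_mul, norm_mul, mul_comm]
      gcongr
      exact h1.trans (le_abs_self _)
    · filter_upwards [hpt] with x hx
      obtain ⟨I, hI, hgx⟩ := hx
      have h2 := (hasPrincipalValue_iff_secondQuot hu).1 hI
      rw [hgx, fracLaplacianConst_half, show Real.pi * (1 / Real.pi * I) = I by field_simp]
      exact h2.const_mul _
  -- the two sides agree by Fubini and the symmetry of the second difference
  have heq : (fun p : ℝ × ℝ => ∫ t in p.1..p.2, ∫ x, u x * secondQuot φ x t)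
      =ᶠ[𝓝[>] 0 ×ˢ atTop] fun p => ∫ x, φ x * ∫ t in p.1..p.2, secondQuot u x t := by
    filter_upwards [eventually_pos_le] with p hp
    have hk : Integrable (fun t : ℝ => (t ^ 2)⁻¹) (volume.restrict (Set.Ioc p.1 p.2)) :=
      (integrableOn_inv_sq_Ioi hp.1).mono_set Set.Ioc_subset_Ioi_self
    have hint : Integrable (fun q : ℝ × ℝ => φ q.1 * secondQuot u q.1 q.2)
        (volume.prod (volume.restrict (Set.Ioc p.1 p.2))) := by
      refine Integrable.mono' (g := fun q : ℝ × ℝ => 4 * B * (|φ q.1| * (q.2 ^ 2)⁻¹))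
        ((φ.integrable.abs.mul_prod hk).const_mul _) ?_ (ae_of_all _ fun q => ?_)
      · have := φ.continuous
        refine Measurable.aestronglyMeasurable ?_
        unfold secondQuot
        fun_prop
      · have h1 := abs_le.1 (hB q.1)
        have h2 := abs_le.1 (hB (q.1 + q.2))
        have h3 := abs_le.1 (hB (q.1 - q.2))
        have h4 : |2 * u q.1 - u (q.1 + q.2) - u (q.1 - q.2)| ≤ 4 * B := by
          rw [abs_le]
          constructor <;> linarith
        rw [secondQuot, norm_mul, norm_div, Real.norm_eq_abs, Real.norm_eq_abs, Real.norm_eq_abs,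
          abs_of_nonneg (sq_nonneg q.2), div_eq_mul_inv]
        calc |φ q.1| * (|2 * u q.1 - u (q.1 + q.2) - u (q.1 - q.2)| * (q.2 ^ 2)⁻¹)
            ≤ |φ q.1| * (4 * B * (q.2 ^ 2)⁻¹) := by gcongr
          _ = _ := by ring
    simp only [integral_mul_secondQuot hu hB φ.integrable, intervalIntegral.integral_of_le hp.2]
    rw [← integral_integral_swap hint]
    simp only [integral_const_mul]
  have h := tendsto_nhds_unique (hlim1.congr' heq) hlim2
  have h' : ∫ x, φ x * (Real.pi * g x) = Real.pi * ∫ x, g x * φ x := by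
    rw [← integral_const_mul]
    congr 1
    ext x
    ring
  rw [h'] at h
  exact (mul_left_cancel₀ Real.pi_ne_zero h).symm

/-! ### Weak derivatives and the weak square root of the Laplacian of boundary functions -/

theorem integrableOn_inv_sqrt_abs :
    IntegrableOn (fun x : ℝ => (√|x|)⁻¹) (Set.Ioo (-1) 1) := by
  have h1 : IntervalIntegrable (fun x : ℝ => (√|x|)⁻¹) volume 0 1 := by
    refine (intervalIntegral.intervalIntegrable_rpow' (r := -(1 / 2)) (by norm_num)).congr ?_
    intro x hx
    rw [Set.uIoc_of_le zero_le_one] at hx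
    simp only [Real.rpow_neg hx.1.le, abs_of_pos hx.1, ← Real.sqrt_eq_rpow]
  have h2 : IntervalIntegrable (fun x : ℝ => (√|x|)⁻¹) volume (-1) 0 := by
    have := ((IntervalIntegrable.iff_comp_neg (by simp)).1 h1).symm
    simpa using this
  exact ((intervalIntegrable_iff_integrableOn_Ioc_of_le (by norm_num)).1 (h2.trans h1)).mono_set
    Set.Ioo_subset_Ioc_self

theorem _root_.SchwartzMap.integrable_inv_sqrt_mul (φ : 𝓢(ℝ, ℝ)) (c : ℝ) :
    Integrable (fun x => (√|x - c|)⁻¹ * φ x) := by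
  obtain ⟨K, hK, h⟩ := φ.exists_abs_le_div
  have hb : ∀ y, |φ y| ≤ K := fun y =>
    (h y).trans (div_le_self hK (by linarith [sq_nonneg y]))
  have hi : Integrable ((Set.Ioo (-1 : ℝ) 1).indicator fun x : ℝ => (√|x|)⁻¹) :=
    integrableOn_inv_sqrt_abs.integrable_indicator measurableSet_Ioo
  have hm := φ.continuous
  refine Integrable.mono' (φ.integrable.abs.add ((hi.comp_sub_right c).const_mul K))
    (Measurable.aestronglyMeasurable (by fun_prop)) (ae_of_all _ fun x => ?_)
  rw [norm_mul, Real.norm_eq_abs, Real.norm_eq_abs, abs_of_nonneg (by positivity), Pi.add_apply]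
  by_cases hx : x - c ∈ Set.Ioo (-1 : ℝ) 1
  · rw [Set.indicator_of_mem hx]
    have : 0 ≤ (√|x - c|)⁻¹ := by positivity
    nlinarith [hb x, abs_nonneg (φ x)]
  · rw [Set.indicator_of_notMem hx, mul_zero, add_zero]
    have h1 : 1 ≤ |x - c| := by
      by_contra hlt
      exact hx (abs_lt.1 (not_le.1 hlt))
    exact mul_le_of_le_one_left (abs_nonneg _) (inv_le_one_of_one_le₀ (Real.one_le_sqrt.2 h1))

theorem ae_ne_and_ne (a b : ℝ) : ∀ᵐ x : ℝ, x ≠ a ∧ x ≠ b :=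
  (Measure.ae_ne volume a).and (Measure.ae_ne volume b)

theorem integrable_weight_mul (C a b : ℝ) (φ : 𝓢(ℝ, ℝ)) :
    Integrable fun x => C * ((√|x - a|)⁻¹ + (√|x - b|)⁻¹) * φ x := by
  refine (((φ.integrable_inv_sqrt_mul a).add (φ.integrable_inv_sqrt_mul b)).const_mul C).congr
    (ae_of_all _ fun x => ?_)
  simp only [Pi.add_apply]
  ring

/-- Integration by parts against a test function, for a bounded continuous function that is
differentiable off a countable set. -/
theorem isWeakDeriv_of_hasDerivAt {u g : ℝ → ℝ} (hu : Continuous u) {B : ℝ}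
    (hB : ∀ x, |u x| ≤ B) {s : Set ℝ} (hs : s.Countable)
    (hd : ∀ x ∉ s, HasDerivAt u (g x) x)
    (hg : ∀ φ : 𝓢(ℝ, ℝ), Integrable fun x => g x * φ x) : IsWeakDeriv u g := by
  intro φ
  have hd1 : ∀ y, HasDerivAt φ (deriv φ y) y := fun y => φ.differentiableAt.hasDerivAt
  have hi : Integrable fun x => u x * deriv φ x :=
    (SchwartzMap.derivCLM ℝ ℝ φ).integrable.bdd_mul (c := B) hu.aestronglyMeasurable
      (ae_of_all _ hB)
  refine ⟨hg φ, hi, ?_⟩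
  have hsum : Integrable fun x => g x * φ x + u x * deriv φ x := (hg φ).add hi
  have h1 : Tendsto (fun R : ℝ => ∫ x in (-R)..R, (g x * φ x + u x * deriv φ x)) atTop
      (𝓝 (∫ x, (g x * φ x + u x * deriv φ x))) :=
    intervalIntegral_tendsto_integral hsum tendsto_neg_atTop_atBot tendsto_id
  have h2 : ∀ R : ℝ, ∫ x in (-R)..R, (g x * φ x + u x * deriv φ x) =
      u R * φ R - u (-R) * φ (-R) := fun R =>
    integral_eq_of_hasDerivAt_off_countable (fun x => u x * φ x) _ hs
      (hu.mul φ.continuous).continuousOn (fun x hx => (hd x hx.2).mul (hd1 x))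
      hsum.intervalIntegrable
  have hz : ∀ {l : Filter ℝ}, l ≤ cocompact ℝ → Tendsto (fun x => u x * φ x) l (𝓝 0) := by
    intro l hl
    have := φ.tendsto_cocompact.mono_left hl
    refine squeeze_zero_norm (a := fun x => B * ‖φ x‖) (fun x => ?_) ?_
    · rw [norm_mul]
      exact mul_le_mul_of_nonneg_right (hB x) (norm_nonneg _)
    · simpa using this.norm.const_mul B
  have h3 : Tendsto (fun R : ℝ => u R * φ R - u (-R) * φ (-R)) atTop (𝓝 (0 - 0)) :=
    (hz atTop_le_cocompact).sub ((hz atBot_le_cocompact).comp tendsto_neg_atTop_atBot)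
  simp only [h2] at h1
  have h4 := tendsto_nhds_unique h1 h3
  rw [integral_add (hg φ) hi] at h4
  linarith

namespace IsBranched

variable {F : ℂ → ℂ} {F' : ℝ → ℂ} {a b c C : ℝ}

theorem abs_le (h : IsBranched F F' a b c C) (L : ℂ →L[ℝ] ℝ) (x : ℝ) : |L (F x)| ≤ ‖L‖ := by
  have := L.le_opNorm (F x)
  rw [Real.norm_eq_abs] at this
  exact this.trans (mul_le_of_le_one_right (norm_nonneg _) (h.norm_le _ (ofReal_mem_upper x)))

theorem norm_deriv_le (h : IsBranched F F' a b c C) {x : ℝ} (ha : x ≠ a) (hb : x ≠ b) :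
    ‖F' x‖ ≤ C * ((√|x - a|)⁻¹ + (√|x - b|)⁻¹) := by
  have hC := h.const_nonneg
  refine (h.hasDerivAt_ofReal ha hb).le_of_lip' (by positivity) (Eventually.of_forall fun y => ?_)
  refine (h.norm_sub_le x ha hb y (ofReal_mem_upper y)).trans_eq ?_
  rw [← Complex.ofReal_sub, Complex.norm_real]

theorem integrable_deriv_mul (h : IsBranched F F' a b c C) (L : ℂ →L[ℝ] ℝ) (φ : 𝓢(ℝ, ℝ)) :
    Integrable fun x => L (F' x) * φ x := by
  have hm : AEStronglyMeasurable F' volume := by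
    refine (measurable_deriv fun y : ℝ => F y).aestronglyMeasurable.congr ?_
    filter_upwards [ae_ne_and_ne a b] with x hx
    exact (h.hasDerivAt_ofReal hx.1 hx.2).deriv
  refine Integrable.mono' ((integrable_weight_mul C a b φ).norm.const_mul ‖L‖)
    ((L.continuous.comp_aestronglyMeasurable hm).mul φ.continuous.aestronglyMeasurable) ?_
  filter_upwards [ae_ne_and_ne a b] with x hx
  rw [norm_mul, norm_mul, ← mul_assoc]
  gcongr
  exact (L.le_opNorm _).trans (mul_le_mul_of_nonneg_left
    ((h.norm_deriv_le hx.1 hx.2).trans (Real.le_norm_self _)) (norm_nonneg _))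

theorem isWeakDeriv (h : IsBranched F F' a b c C) (L : ℂ →L[ℝ] ℝ) :
    IsWeakDeriv (fun y => L (F y)) (fun x => L (F' x)) := by
  refine isWeakDeriv_of_hasDerivAt (s := {a, b}) (L.continuous.comp h.continuous_ofReal)
    (h.abs_le L) (Set.toFinite _).countable (fun x hx => ?_) (h.integrable_deriv_mul L)
  simp only [Set.mem_insert_iff, Set.mem_singleton_iff, not_or] at hx
  exact h.hasDerivAt L hx.1 hx.2

/-- The truncated singular integrals of `(-Δ)^(1/2)` are integrals of a difference quotient over
two half circles, hence are bounded uniformly in the radii. -/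
theorem abs_integral_secondQuot_le (h : IsBranched F F' a b c C) (L : ℂ →L[ℝ] ℝ) {x : ℝ}
    (ha : x ≠ a) (hb : x ≠ b) {ε R : ℝ} (hε : 0 < ε) (hR : ε ≤ R) :
    |∫ t in ε..R, secondQuot (fun y => L (F y)) x t| ≤
      ‖L‖ * (2 * Real.pi) * C * ((√|x - a|)⁻¹ + (√|x - b|)⁻¹) := by
  set W := C * ((√|x - a|)⁻¹ + (√|x - b|)⁻¹) with hW
  set g : ℂ → ℂ := fun z => (F x - F z) / (x - z) ^ 2 with hg
  have hgc : ContinuousOn g (upper \ {(x : ℂ)}) := h.quotient_continuousOn x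
  have harc : ∀ r : ℝ, 0 < r → ‖arc g x r‖ ≤ W * Real.pi := by
    intro r hr
    refine norm_arc_le hr fun z hz hzr => ?_
    have hzx : ‖(x : ℂ) - z‖ = r := by rw [norm_sub_rev]; exact hzr
    rw [hg, norm_mul, norm_div, norm_pow, hzr, hzx, norm_sub_rev]
    have := h.norm_sub_le x ha hb z hz
    rw [hzr] at this
    rw [show r * (‖F z - F x‖ / r ^ 2) = ‖F z - F x‖ / r by field_simp, div_le_iff₀ hr]
    exact this
  have e : ∫ t in ε..R, secondQuot (fun y => L (F y)) x t =
      L (Complex.I * (arc g x ε - arc g x R)) := by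
    rw [← integral_half_annulus hgc (h.quotient_differentiableAt x) hε hR,
      ← integral_clm_boundary hgc L hε hR]
    congr 1
    ext r
    rw [← fold_eq_secondQuot, hg]
    simp only [quotient_ofReal]
  rw [e, ← Real.norm_eq_abs]
  calc ‖L (Complex.I * (arc g x ε - arc g x R))‖
      ≤ ‖L‖ * ‖Complex.I * (arc g x ε - arc g x R)‖ := L.le_opNorm _
    _ ≤ ‖L‖ * (W * Real.pi + W * Real.pi) := by
        rw [norm_mul, Complex.norm_I, one_mul]
        gcongr
        exact (_root_.norm_sub_le _ _).trans (add_le_add (harc ε hε) (harc R (hε.trans_le hR)))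
    _ = _ := by rw [hW]; ring

theorem isFracLaplacian (h : IsBranched F F' a b c C) (L : ℂ →L[ℝ] ℝ) :
    IsFracLaplacian (1 / 2) (fun y => L (F y)) (fun x => L (-Complex.I * F' x)) := by
  refine isFracLaplacian_of_dominated
    (M := fun x => ‖L‖ * (2 * Real.pi) * C * ((√|x - a|)⁻¹ + (√|x - b|)⁻¹))
    (L.continuous.comp h.continuous_ofReal) (h.abs_le L) ?_ (integrable_weight_mul _ a b) ?_ ?_
  · filter_upwards [ae_ne_and_ne a b] with x hx using h.hasFracLaplacianAt L hx.1 hx.2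
  · intro φ
    have := h.integrable_deriv_mul (L.comp ((ContinuousLinearMap.mul ℝ ℂ) (-Complex.I))) φ
    simpa using this
  · filter_upwards [ae_ne_and_ne a b] with x hx ε R hε hR
    exact h.abs_integral_secondQuot_le L hx.1 hx.2 hε hR

end IsBranched

/-! ### The square root on the upper half plane -/

/-- The square root on the closed upper half plane with values in the closed first quadrant. The
formula in terms of real square roots is continuous on the whole plane, so that no branch cut meets
the real line; it is a square root only on the closed upper half plane. -/
def upperSqrt (z : ℂ) : ℂ := ⟨√((‖z‖ + z.re) / 2), √((‖z‖ - z.re) / 2)⟩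

theorem upperSqrt_re_nonneg (z : ℂ) : 0 ≤ (upperSqrt z).re := Real.sqrt_nonneg _

theorem upperSqrt_im_nonneg (z : ℂ) : 0 ≤ (upperSqrt z).im := Real.sqrt_nonneg _

theorem continuous_upperSqrt : Continuous upperSqrt := by
  have : upperSqrt = fun z : ℂ =>
      ((√((‖z‖ + z.re) / 2) : ℝ) : ℂ) + ((√((‖z‖ - z.re) / 2) : ℝ) : ℂ) * Complex.I := by
    ext z
    exact (Complex.mk_eq_add_mul_I _ _)
  rw [this]
  have h1 := Complex.continuous_re
  fun_prop

theorem upperSqrt_sq {z : ℂ} (hz : z ∈ upper) : upperSqrt z ^ 2 = z := by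
  have hre := _root_.abs_le.1 (Complex.abs_re_le_norm z)
  have h1 : 0 ≤ (‖z‖ + z.re) / 2 := by linarith [hre.1]
  have h2 : 0 ≤ (‖z‖ - z.re) / 2 := by linarith [hre.2]
  rw [sq]
  apply Complex.ext
  · simp only [upperSqrt, Complex.mul_re]
    rw [Real.mul_self_sqrt h1, Real.mul_self_sqrt h2]
    ring
  · simp only [upperSqrt, Complex.mul_im]
    rw [mul_comm (√((‖z‖ - z.re) / 2)), ← Real.sqrt_mul h1,
      show (‖z‖ + z.re) / 2 * ((‖z‖ - z.re) / 2) = (z.im / 2) ^ 2 by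
        have := Complex.sq_norm z
        rw [Complex.normSq_apply] at this
        linear_combination this / 4,
      Real.sqrt_sq (by have : 0 ≤ z.im := hz; positivity)]
    ring

theorem norm_upperSqrt {z : ℂ} (hz : z ∈ upper) : ‖upperSqrt z‖ = √‖z‖ := by
  rw [← Real.sqrt_sq (norm_nonneg (upperSqrt z)), ← norm_pow, upperSqrt_sq hz]

/-- In the closed first quadrant, norms of sums dominate Euclidean sums. -/
theorem norm_sq_add_le (z w : ℂ) :
    ‖upperSqrt z‖ ^ 2 + ‖upperSqrt w‖ ^ 2 ≤ ‖upperSqrt z + upperSqrt w‖ ^ 2 := by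
  simp only [Complex.sq_norm, Complex.normSq_apply, Complex.add_re, Complex.add_im]
  nlinarith [mul_nonneg (upperSqrt_re_nonneg z) (upperSqrt_re_nonneg w),
    mul_nonneg (upperSqrt_im_nonneg z) (upperSqrt_im_nonneg w)]

theorem norm_upperSqrt_le_add (z w : ℂ) : ‖upperSqrt w‖ ≤ ‖upperSqrt z + upperSqrt w‖ := by
  have := norm_sq_add_le z w
  exact le_of_sq_le_sq (by nlinarith [sq_nonneg ‖upperSqrt z‖]) (norm_nonneg _)

theorem upperSqrt_sub_mul_add {z w : ℂ} (hz : z ∈ upper) (hw : w ∈ upper) :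
    (upperSqrt z - upperSqrt w) * (upperSqrt z + upperSqrt w) = z - w := by
  linear_combination upperSqrt_sq hz - upperSqrt_sq hw

theorem upperSqrt_ne_zero {z : ℂ} (hz : z ∈ upper) (h0 : z ≠ 0) : upperSqrt z ≠ 0 := by
  intro h
  rw [← upperSqrt_sq hz, h] at h0
  simp at h0

theorem upperSqrt_add_ne_zero (z : ℂ) {w : ℂ} (hw : w ∈ upper) (h0 : w ≠ 0) :
    upperSqrt z + upperSqrt w ≠ 0 := by
  intro h
  have := norm_upperSqrt_le_add z w
  rw [h, norm_zero] at this
  exact upperSqrt_ne_zero hw h0 (norm_le_zero_iff.1 this)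

/-- Since both square roots lie in the first quadrant, their sum is at least as large as each of
them. This bounds the difference quotient at `w` uniformly over the upper half plane. -/
theorem norm_upperSqrt_sub_le {z w : ℂ} (hz : z ∈ upper) (hw : w ∈ upper) (h0 : w ≠ 0) :
    ‖upperSqrt z - upperSqrt w‖ ≤ (√‖w‖)⁻¹ * ‖z - w‖ := by
  have h := congrArg norm (upperSqrt_sub_mul_add hz hw)
  rw [norm_mul] at h
  have h1 := norm_upperSqrt_le_add z w
  rw [norm_upperSqrt hw] at h1
  have h2 : 0 < √‖w‖ := Real.sqrt_pos.2 (norm_pos_iff.2 h0)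
  rw [← h, inv_mul_eq_div, le_div_iff₀ h2]
  gcongr

theorem hasDerivWithinAt_upperSqrt {w : ℂ} (hw : w ∈ upper) (h0 : w ≠ 0) :
    HasDerivWithinAt upperSqrt (2 * upperSqrt w)⁻¹ upper w := by
  rw [hasDerivWithinAt_iff_tendsto_slope]
  have h : Tendsto (fun z => (upperSqrt z + upperSqrt w)⁻¹) (𝓝[upper \ {w}] w)
      (𝓝 (2 * upperSqrt w)⁻¹) := by
    rw [two_mul]
    refine Tendsto.inv₀ ?_ (upperSqrt_add_ne_zero w hw h0)
    exact ((continuous_upperSqrt.tendsto w).mono_left nhdsWithin_le_nhds).add_const _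
  refine h.congr' ?_
  filter_upwards [self_mem_nhdsWithin] with z hz
  have h1 := upperSqrt_add_ne_zero z hw h0
  have h2 : z - w ≠ 0 := sub_ne_zero.2 hz.2
  rw [slope_def_field, eq_div_iff h2, ← upperSqrt_sub_mul_add hz.1 hw]
  field_simp

theorem upperSqrt_ofReal_of_nonneg {x : ℝ} (hx : 0 ≤ x) : upperSqrt x = (√x : ℝ) := by
  apply Complex.ext <;> simp [upperSqrt, abs_of_nonneg hx]

theorem upperSqrt_ofReal_of_nonpos {x : ℝ} (hx : x ≤ 0) :
    upperSqrt x = (√(-x) : ℝ) * Complex.I := by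
  apply Complex.ext
  · simp [upperSqrt, abs_of_nonpos hx]
  · have : (-x - x) / 2 = -x := by ring
    simp [upperSqrt, abs_of_nonpos hx, this]

/-! ### The inverse Joukowski map -/

/-- The inverse Joukowski map `w - √(w + 1) √(w - 1)` from the upper half plane to the unit
disc. -/
def joukowski (w : ℂ) : ℂ := w - upperSqrt (w + 1) * upperSqrt (w - 1)

theorem add_one_mem_upper {w : ℂ} (hw : w ∈ upper) : w + 1 ∈ upper := by simpa [upper] using hw

theorem sub_one_mem_upper {w : ℂ} (hw : w ∈ upper) : w - 1 ∈ upper := by simpa [upper] using hw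

theorem joukowski_eq {w : ℂ} (hw : w ∈ upper) :
    joukowski w = (upperSqrt (w + 1) - upperSqrt (w - 1)) ^ 2 / 2 := by
  have h1 := upperSqrt_sq (add_one_mem_upper hw)
  have h2 := upperSqrt_sq (sub_one_mem_upper hw)
  rw [joukowski]
  linear_combination -h1 / 2 - h2 / 2

/-- The reciprocal of the inverse Joukowski map is `(√(w + 1) + √(w - 1))² / 2`; its size gives the
bounds by `1` and by `1 / |w|`. -/
theorem joukowski_mul {w : ℂ} (hw : w ∈ upper) :
    joukowski w * ((upperSqrt (w + 1) + upperSqrt (w - 1)) ^ 2 / 2) = 1 := by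
  have h := upperSqrt_sub_mul_add (add_one_mem_upper hw) (sub_one_mem_upper hw)
  rw [joukowski_eq hw]
  linear_combination
    ((upperSqrt (w + 1) - upperSqrt (w - 1)) * (upperSqrt (w + 1) + upperSqrt (w - 1)) + 2) / 4 * h

theorem norm_joukowski_mul_le {w : ℂ} (hw : w ∈ upper) {r : ℝ}
    (hr : 2 * r ≤ ‖w + 1‖ + ‖w - 1‖) : ‖joukowski w‖ * r ≤ 1 := by
  have h := congrArg norm (joukowski_mul hw)
  rw [norm_mul, norm_div, norm_pow, norm_one, Complex.norm_two] at h
  have h1 := norm_sq_add_le (w + 1) (w - 1)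
  rw [norm_upperSqrt (add_one_mem_upper hw), norm_upperSqrt (sub_one_mem_upper hw),
    Real.sq_sqrt (norm_nonneg _), Real.sq_sqrt (norm_nonneg _)] at h1
  rw [← h]
  gcongr
  linarith

theorem norm_joukowski_le_one {w : ℂ} (hw : w ∈ upper) : ‖joukowski w‖ ≤ 1 := by
  have := norm_joukowski_mul_le hw (r := 1) (by
    have := _root_.norm_sub_le (w + 1) (w - 1)
    rw [show w + 1 - (w - 1) = 2 by ring, Complex.norm_two] at this
    linarith)
  simpa using this

theorem norm_joukowski_mul_norm_le {w : ℂ} (hw : w ∈ upper) : ‖joukowski w‖ * ‖w‖ ≤ 1 :=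
  norm_joukowski_mul_le hw (by
    have := norm_add_le (w + 1) (w - 1)
    rwa [show w + 1 + (w - 1) = 2 * w by ring, norm_mul, Complex.norm_two] at this)

theorem joukowski_tendsto :
    Tendsto joukowski (Bornology.cobounded ℂ ⊓ 𝓟 upper) (𝓝 0) := by
  refine squeeze_zero_norm' (a := fun w => ‖w‖⁻¹) ?_
    ((tendsto_inv_atTop_zero.comp tendsto_norm_cobounded_atTop).mono_left inf_le_left)
  filter_upwards [mem_inf_of_right (mem_principal_self upper),
    mem_inf_of_left (eventually_cobounded_le_norm (1 : ℝ))] with w hw hw1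
  rw [← one_div, le_div_iff₀ (by linarith)]
  exact norm_joukowski_mul_norm_le hw

theorem continuous_joukowski : Continuous joukowski := by
  have := continuous_upperSqrt
  unfold joukowski
  fun_prop

/-- The map is half the square of `√(w + 1) - √(w - 1)`, which is bounded and a difference of
functions with controlled difference quotients. -/
theorem norm_joukowski_sub_le {x : ℝ} (h1 : x ≠ -1) (h2 : x ≠ 1) {w : ℂ} (hw : w ∈ upper) :
    ‖joukowski w - joukowski x‖ ≤ 2 * ((√|x + 1|)⁻¹ + (√|x - 1|)⁻¹) * ‖w - x‖ := by
  have hx := ofReal_mem_upper x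
  have hD : ∀ {v : ℂ}, v ∈ upper → ‖upperSqrt (v + 1) - upperSqrt (v - 1)‖ ≤ 2 := by
    intro v hv
    have := norm_joukowski_le_one hv
    rw [joukowski_eq hv, norm_div, norm_pow, Complex.norm_two] at this
    nlinarith [norm_nonneg (upperSqrt (v + 1) - upperSqrt (v - 1))]
  have hP := norm_upperSqrt_sub_le (add_one_mem_upper hw) (add_one_mem_upper hx) (by
    norm_cast
    exact fun h => h1 (by linarith))
  have hQ := norm_upperSqrt_sub_le (sub_one_mem_upper hw) (sub_one_mem_upper hx) (by
    norm_cast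
    exact fun h => h2 (by linarith))
  rw [show w + 1 - (x + 1 : ℂ) = w - x by ring,
    show ‖(x + 1 : ℂ)‖ = |x + 1| by norm_cast] at hP
  rw [show w - 1 - (x - 1 : ℂ) = w - x by ring,
    show ‖(x - 1 : ℂ)‖ = |x - 1| by norm_cast] at hQ
  have e : joukowski w - joukowski x =
      ((upperSqrt (w + 1) - upperSqrt (x + 1)) - (upperSqrt (w - 1) - upperSqrt (x - 1))) *
      ((upperSqrt (w + 1) - upperSqrt (w - 1)) + (upperSqrt (x + 1) - upperSqrt (x - 1))) / 2 := by
    rw [joukowski_eq hw, joukowski_eq hx]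
    ring
  rw [e, norm_div, norm_mul, Complex.norm_two, div_le_iff₀ two_pos]
  have h3 := (_root_.norm_sub_le (upperSqrt (w + 1) - upperSqrt (x + 1))
    (upperSqrt (w - 1) - upperSqrt (x - 1))).trans (add_le_add hP hQ)
  have h4 := (norm_add_le (upperSqrt (w + 1) - upperSqrt (w - 1))
    (upperSqrt (x + 1) - upperSqrt (x - 1))).trans (add_le_add (hD hw) (hD hx))
  calc _ ≤ ((√|x + 1|)⁻¹ * ‖w - x‖ + (√|x - 1|)⁻¹ * ‖w - x‖) * (2 + 2) := by gcongr
    _ = _ := by ring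

theorem hasDerivWithinAt_joukowski {w : ℂ} (hw : w ∈ upper) (h1 : w ≠ -1) (h2 : w ≠ 1) :
    HasDerivWithinAt joukowski
      (-(joukowski w / (upperSqrt (w + 1) * upperSqrt (w - 1)))) upper w := by
  have h1' : w + 1 ≠ 0 := fun h => h1 (eq_neg_of_add_eq_zero_left h)
  have h2' : w - 1 ≠ 0 := sub_ne_zero.2 h2
  have hP : HasDerivWithinAt (fun w => upperSqrt (w + 1)) ((2 * upperSqrt (w + 1))⁻¹ * 1) upper w :=
    HasDerivWithinAt.comp (h₂ := upperSqrt) (h := fun w => w + 1) w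
      (hasDerivWithinAt_upperSqrt (add_one_mem_upper hw) h1')
      ((hasDerivWithinAt_id w upper).add_const 1) fun z hz => add_one_mem_upper hz
  have hQ : HasDerivWithinAt (fun w => upperSqrt (w - 1)) ((2 * upperSqrt (w - 1))⁻¹ * 1) upper w :=
    HasDerivWithinAt.comp (h₂ := upperSqrt) (h := fun w => w - 1) w
      (hasDerivWithinAt_upperSqrt (sub_one_mem_upper hw) h2')
      ((hasDerivWithinAt_id w upper).sub_const 1) fun z hz => sub_one_mem_upper hz
  refine ((hasDerivWithinAt_id w upper).sub (hP.mul hQ)).congr_deriv ?_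
  have e1 := upperSqrt_sq (add_one_mem_upper hw)
  have e2 := upperSqrt_sq (sub_one_mem_upper hw)
  have n1 := upperSqrt_ne_zero (add_one_mem_upper hw) h1'
  have n2 := upperSqrt_ne_zero (sub_one_mem_upper hw) h2'
  rw [joukowski]
  field_simp
  linear_combination -e1 - e2

theorem norm_pow_sub_pow_le {u v : ℂ} (hu : ‖u‖ ≤ 1) (hv : ‖v‖ ≤ 1) (n : ℕ) :
    ‖u ^ n - v ^ n‖ ≤ n * ‖u - v‖ := by
  induction n with
  | zero => simp
  | succ n ih =>
    rw [show u ^ (n + 1) - v ^ (n + 1) = u * (u ^ n - v ^ n) + (u - v) * v ^ n by ring]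
    refine (norm_add_le _ _).trans ?_
    rw [norm_mul, norm_mul, norm_pow]
    have h1 : ‖u‖ * ‖u ^ n - v ^ n‖ ≤ 1 * (n * ‖u - v‖) := by gcongr
    have h2 : ‖u - v‖ * ‖v‖ ^ n ≤ ‖u - v‖ * 1 := by
      gcongr
      exact pow_le_one₀ (norm_nonneg _) hv
    push_cast
    linarith

/-- The derivative of a power of the inverse Joukowski map at a real point other than `±1`. At `±1`
the denominator vanishes and the value is `0`. -/
def joukowskiPowDeriv (n : ℕ) (x : ℝ) : ℂ :=
  -(n * joukowski x ^ n / (upperSqrt (x + 1) * upperSqrt (x - 1)))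

/-- Powers of the inverse Joukowski map, transplanted from `[-1, 1]` to `[a, b]`. -/
theorem isBranched_joukowski_pow {a b : ℝ} (hab : a < b) (n : ℕ) :
    IsBranched (fun z => joukowski (2 / (b - a) * (z - (a + b) / 2)) ^ n)
      (fun x => 2 / (b - a) * joukowskiPowDeriv n (aff a b x)) a b (if n = 0 then 1 else 0)
      (n * 2 * (2 / (b - a)) / √(2 / (b - a))) := by
  have hk : 0 < 2 / (b - a) := div_pos two_pos (sub_pos.2 hab)
  set k := 2 / (b - a) with hkdef
  have hkc : (2 / (b - a) : ℂ) = (k : ℝ) := by rw [hkdef]; push_cast; rfl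
  have hmem : ∀ z ∈ upper, (k * (z - (a + b) / 2) : ℂ) ∈ upper := by
    intro z hz
    have : 0 ≤ k * z.im := mul_nonneg hk.le hz
    have h2 : ((a + b : ℂ) / 2).im = 0 := by
      rw [← Complex.ofReal_add, ← Complex.ofReal_ofNat, ← Complex.ofReal_div, Complex.ofReal_im]
    simpa [upper, h2] using this
  have hreal : ∀ x : ℝ, (k * ((x : ℂ) - (a + b) / 2) : ℂ) = (aff a b x : ℝ) := by
    intro x
    rw [aff, ← hkdef]
    push_cast
    rfl
  have ha : ∀ x, aff a b x + 1 = k * (x - a) := by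
    intro x
    have : b - a ≠ 0 := (sub_pos.2 hab).ne'
    rw [aff, hkdef]
    field_simp
    ring
  have hb : ∀ x, aff a b x - 1 = k * (x - b) := by
    intro x
    have : b - a ≠ 0 := (sub_pos.2 hab).ne'
    rw [aff, hkdef]
    field_simp
    ring
  have hne1 : ∀ x, x ≠ a → aff a b x ≠ -1 := by
    intro x hx h
    have := ha x
    rw [h, neg_add_cancel, eq_comm, mul_eq_zero, sub_eq_zero] at this
    exact this.elim hk.ne' hx
  have hne2 : ∀ x, x ≠ b → aff a b x ≠ 1 := by
    intro x hx h
    have := hb x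
    rw [h, sub_self, eq_comm, mul_eq_zero, sub_eq_zero] at this
    exact this.elim hk.ne' hx
  rw [hkc]
  have hD : ∀ z ∈ upper, (k * (z - (a + b) / 2) : ℂ) ≠ -1 → (k * (z - (a + b) / 2) : ℂ) ≠ 1 →
      HasDerivWithinAt (fun z : ℂ => joukowski (k * (z - (a + b) / 2)) ^ n)
        (n * joukowski (k * (z - (a + b) / 2)) ^ (n - 1) *
          (-(joukowski (k * (z - (a + b) / 2)) / (upperSqrt (k * (z - (a + b) / 2) + 1) *
            upperSqrt (k * (z - (a + b) / 2) - 1))) * (k * 1))) upper z := by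
    intro z hz h1 h2
    refine HasDerivWithinAt.fun_pow ?_ n
    exact (hasDerivWithinAt_joukowski (hmem z hz) h1 h2).comp z
      (((hasDerivWithinAt_id z upper).sub_const _).const_mul (k : ℂ)) hmem
  -- the factor `√(2 / (b - a))` comes from rescaling the weights `|x ± 1|^(-1/2)`
  refine ⟨?_, ?_, ?_, ?_, ?_, by positivity, ?_⟩
  · have := continuous_joukowski
    exact Continuous.continuousOn (by fun_prop)
  · intro z hz
    have him : 0 < (k * (z - (a + b) / 2) : ℂ).im := by
      have h2 : ((a + b : ℂ) / 2).im = 0 := by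
        rw [← Complex.ofReal_add, ← Complex.ofReal_ofNat, ← Complex.ofReal_div, Complex.ofReal_im]
      simpa [h2] using mul_pos hk hz
    refine ((hD z hz.le ?_ ?_).hasDerivAt ?_).differentiableAt
    · intro h
      simp [h] at him
    · intro h
      simp [h] at him
    · exact mem_of_superset ((isOpen_lt continuous_const Complex.continuous_im).mem_nhds hz)
        fun w hw => le_of_lt (show 0 < w.im from hw)
  · split_ifs with h0
    · simp [h0, tendsto_const_nhds]
    · have ht : Tendsto (fun z : ℂ => (k * (z - (a + b) / 2) : ℂ))
          (Bornology.cobounded ℂ ⊓ 𝓟 upper) (Bornology.cobounded ℂ ⊓ 𝓟 upper) := by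
        refine tendsto_inf.2 ⟨?_, ?_⟩
        · refine Tendsto.mono_left ?_ inf_le_left
          rw [← tendsto_norm_atTop_iff_cobounded]
          simp only [norm_mul]
          exact (tendsto_norm_cobounded_atTop.comp (tendsto_sub_const_cobounded _)).const_mul_atTop
            (norm_pos_iff.2 (by exact_mod_cast hk.ne'))
        · exact tendsto_principal.2 (mem_inf_of_right (mem_principal.2 hmem))
      simpa [h0] using (joukowski_tendsto.comp ht).pow n
  · intro z hz
    rw [norm_pow]
    exact pow_le_one₀ (norm_nonneg _) (norm_joukowski_le_one (hmem z hz))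
  · intro x hxa hxb
    have := hD x (ofReal_mem_upper x) (by rw [hreal]; exact_mod_cast hne1 x hxa)
      (by rw [hreal]; exact_mod_cast hne2 x hxb)
    refine this.congr_deriv ?_
    rw [hreal, joukowskiPowDeriv]
    rcases n with _ | n
    · simp
    · rw [Nat.add_sub_cancel, pow_succ]
      ring
  · intro x hxa hxb z hz
    simp only [hreal]
    have hx := ofReal_mem_upper (aff a b x)
    refine (norm_pow_sub_pow_le (norm_joukowski_le_one (hmem z hz))
      (norm_joukowski_le_one hx) n).trans ?_
    have h := norm_joukowski_sub_le (hne1 x hxa) (hne2 x hxb) (hmem z hz)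
    rw [ha, hb, abs_mul, abs_mul, abs_of_pos hk, Real.sqrt_mul hk.le, Real.sqrt_mul hk.le,
      mul_inv, mul_inv, ← hreal, ← mul_sub, norm_mul, Complex.norm_real, Real.norm_eq_abs,
      abs_of_pos hk, sub_sub_sub_cancel_right] at h
    rw [← hreal]
    refine (mul_le_mul_of_nonneg_left h (Nat.cast_nonneg n)).trans_eq ?_
    field_simp

/-! ### Boundary values: weighted and extended Chebyshev functions -/

theorem upperSqrt_mul_ofReal_of_abs_le {x : ℝ} (hx : |x| ≤ 1) :
    upperSqrt (x + 1) * upperSqrt (x - 1) = (√(1 - x ^ 2) : ℝ) * Complex.I := by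
  have h := abs_le.1 hx
  have e1 : (x + 1 : ℂ) = ((x + 1 : ℝ) : ℂ) := by push_cast; rfl
  have e2 : (x - 1 : ℂ) = ((x - 1 : ℝ) : ℂ) := by push_cast; rfl
  rw [e1, e2, upperSqrt_ofReal_of_nonneg (by linarith), upperSqrt_ofReal_of_nonpos (by linarith),
    ← mul_assoc, ← Complex.ofReal_mul, ← Real.sqrt_mul (by linarith)]
  congr 4
  ring

theorem upperSqrt_mul_ofReal_of_lt_abs {x : ℝ} (hx : 1 < |x|) :
    upperSqrt (x + 1) * upperSqrt (x - 1) = (Real.sign x * √(x ^ 2 - 1) : ℝ) := by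
  have e1 : (x + 1 : ℂ) = ((x + 1 : ℝ) : ℂ) := by push_cast; rfl
  have e2 : (x - 1 : ℂ) = ((x - 1 : ℝ) : ℂ) := by push_cast; rfl
  rw [e1, e2]
  rcases lt_abs.1 hx with h | h
  · rw [upperSqrt_ofReal_of_nonneg (by linarith), upperSqrt_ofReal_of_nonneg (by linarith),
      ← Complex.ofReal_mul, ← Real.sqrt_mul (by linarith), Real.sign_of_pos (by linarith), one_mul]
    congr 3
    ring
  · have hI : ∀ p q : ℂ, p * Complex.I * (q * Complex.I) = -(p * q) := fun p q => by
      linear_combination p * q * Complex.I_sq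
    rw [upperSqrt_ofReal_of_nonpos (by linarith), upperSqrt_ofReal_of_nonpos (by linarith),
      Real.sign_of_neg (by linarith), hI, ← Complex.ofReal_mul, ← Real.sqrt_mul (by linarith),
      show -(x + 1) * -(x - 1) = x ^ 2 - 1 by ring]
    push_cast
    ring

/-- De Moivre's formula with `x = cos θ` and `√(1 - x²) = sin θ`. -/
theorem chebyshev_pow {x : ℝ} (hx : |x| ≤ 1) (m : ℕ) :
    ((x : ℂ) - √(1 - x ^ 2) * Complex.I) ^ (m + 1) =
      (Polynomial.Chebyshev.T ℝ (m + 1 : ℕ)).eval x -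
        Complex.I * (√(1 - x ^ 2) * (Polynomial.Chebyshev.U ℝ m).eval x : ℝ) := by
  have hs : (√(1 - x ^ 2) : ℂ) ^ 2 = 1 - x ^ 2 := by
    rw [← Complex.ofReal_pow, Real.sq_sqrt (by
      have := (sq_le_one_iff_abs_le_one x).2 hx
      linarith)]
    push_cast
    rfl
  induction m with
  | zero => simp; ring
  | succ m ih =>
    rw [pow_succ, ih]
    have hT := congrArg (Polynomial.eval x) (Polynomial.Chebyshev.T_eq_X_mul_T_sub_pol_U ℝ m)
    have hU := congrArg (Polynomial.eval x) (Polynomial.Chebyshev.U_eq_X_mul_U_add_T ℝ m)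
    simp only [Polynomial.eval_sub, Polynomial.eval_add, Polynomial.eval_mul, Polynomial.eval_X,
      Polynomial.eval_pow, Polynomial.eval_one] at hT hU
    have e1 : ((m + 1 : ℕ) : ℤ) = m + 1 := by push_cast; rfl
    have e2 : ((m + 1 + 1 : ℕ) : ℤ) = m + 2 := by push_cast; ring
    rw [e1, e2, hT, hU]
    generalize (Polynomial.Chebyshev.T ℝ (m + 1)).eval x = t
    generalize (Polynomial.Chebyshev.U ℝ m).eval x = v
    push_cast
    linear_combination -(v : ℂ) * hs + (√(1 - x ^ 2) : ℂ) ^ 2 * (v : ℂ) * Complex.I_sq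

theorem joukowski_ofReal_of_abs_le {x : ℝ} (hx : |x| ≤ 1) :
    joukowski x = x - √(1 - x ^ 2) * Complex.I := by
  rw [joukowski, upperSqrt_mul_ofReal_of_abs_le hx]

theorem joukowski_ofReal_of_lt_abs {x : ℝ} (hx : 1 < |x|) :
    joukowski x = (x - Real.sign x * √(x ^ 2 - 1) : ℝ) := by
  rw [joukowski, upperSqrt_mul_ofReal_of_lt_abs hx]
  push_cast
  rfl

/-- The boundary values of the powers of the inverse Joukowski map. -/
theorem joukowski_pow_ofReal (m : ℕ) (x : ℝ) :
    joukowski x ^ (m + 1) = extT (m + 1) x - Complex.I * wU m x := by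
  rcases le_or_gt |x| 1 with hx | hx
  · rw [joukowski_ofReal_of_abs_le hx, chebyshev_pow hx, extT, if_pos hx, wU]
    congr 3
    split_ifs with h
    · rfl
    · have h1 : |x| = 1 := le_antisymm hx (not_lt.1 h)
      rw [← sq_abs, h1]
      simp
  · rw [joukowski_ofReal_of_lt_abs hx, extT, if_neg hx.not_ge, wU, if_neg hx.not_gt]
    push_cast
    ring

theorem extT_zero (x : ℝ) : extT 0 x = 1 := by
  simp [extT]

theorem extU_of_abs_le {x : ℝ} (hx : |x| ≤ 1) (m : ℕ) :
    extU (m + 2) x = (Polynomial.Chebyshev.U ℝ m).eval x := by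
  induction m using Nat.twoStepInduction with
  | zero => simp [extU, extT_zero, hx]
  | one => simp [extU, extT, hx]
  | more m ih _ =>
    have hU := congrArg (Polynomial.eval x) (Polynomial.Chebyshev.U_eq_two_mul_T_add_U ℝ m)
    simp only [Polynomial.eval_add, Polynomial.eval_mul, Polynomial.eval_ofNat] at hU
    have e1 : ((m + 1 + 1 : ℕ) : ℤ) = m + 2 := by push_cast; ring
    rw [extU, ih, extT, if_pos hx, e1, ← hU]

theorem sign_mul_sqrt_sq {x : ℝ} (hx : 1 < |x|) :
    (Real.sign x * √(x ^ 2 - 1)) ^ 2 = x ^ 2 - 1 ∧ Real.sign x * √(x ^ 2 - 1) ≠ 0 := by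
  have h1 : 0 < x ^ 2 - 1 := by
    rw [← sq_abs]
    nlinarith
  have h2 : (Real.sign x) ^ 2 = 1 := by
    rcases lt_abs.1 hx with h | h
    · rw [Real.sign_of_pos (by linarith), one_pow]
    · rw [Real.sign_of_neg (by linarith), neg_one_sq]
  have h3 : (Real.sign x * √(x ^ 2 - 1)) ^ 2 = x ^ 2 - 1 := by
    rw [mul_pow, h2, Real.sq_sqrt h1.le, one_mul]
  exact ⟨h3, fun h => by rw [h] at h3; norm_num at h3; linarith⟩

theorem extU_of_lt_abs {x : ℝ} (hx : 1 < |x|) (m : ℕ) :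
    extU (m + 2) x = -((x - Real.sign x * √(x ^ 2 - 1)) ^ (m + 1) /
      (Real.sign x * √(x ^ 2 - 1))) := by
  obtain ⟨hs, hs0⟩ := sign_mul_sqrt_sq hx
  have hsgn : |x| / √(x ^ 2 - 1) = x / (Real.sign x * √(x ^ 2 - 1)) ∧
      Real.sign x / √(x ^ 2 - 1) = 1 / (Real.sign x * √(x ^ 2 - 1)) := by
    rcases lt_abs.1 hx with h | h
    · rw [Real.sign_of_pos (by linarith), abs_of_pos (by linarith)]
      simp
    · rw [Real.sign_of_neg (by linarith), abs_of_neg (by linarith)]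
      simp [neg_div, div_neg]
  induction m using Nat.twoStepInduction with
  | zero =>
    rw [extU, extT_zero, extU, if_neg hx.not_ge, hsgn.1]
    generalize Real.sign x * √(x ^ 2 - 1) = s at hs hs0
    field_simp
    ring
  | one =>
    rw [extU, extT, extU, if_neg hx.not_ge, if_neg hx.not_ge, hsgn.2]
    generalize Real.sign x * √(x ^ 2 - 1) = s at hs hs0
    field_simp
    linear_combination -hs
  | more m ih _ =>
    rw [extU, ih, extT, if_neg hx.not_ge]
    generalize Real.sign x * √(x ^ 2 - 1) = s at hs hs0
    field_simp
    linear_combination -(x - s) ^ (m + 1) * hs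

/-- The derivatives of the boundary values of the powers of the inverse Joukowski map. -/
theorem joukowskiPowDeriv_eq (m : ℕ) {x : ℝ} (hx : |x| ≠ 1) :
    joukowskiPowDeriv (m + 1) x =
      (m + 1) * (extU (m + 2) x + Complex.I * wT (m + 1) x) := by
  rcases lt_or_gt_of_ne hx with hx | hx
  · have h1 : 0 < 1 - x ^ 2 := by
      have := (sq_lt_one_iff_abs_lt_one x).2 hx
      linarith
    have hs : (√(1 - x ^ 2) : ℂ) ≠ 0 := by exact_mod_cast (Real.sqrt_pos.2 h1).ne'
    rw [joukowskiPowDeriv, upperSqrt_mul_ofReal_of_abs_le hx.le, joukowski_ofReal_of_abs_le hx.le,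
      chebyshev_pow hx.le, extU_of_abs_le hx.le, wT, if_pos hx]
    have hI := Complex.I_ne_zero
    generalize (Polynomial.Chebyshev.T ℝ (m + 1 : ℕ)).eval x = t
    generalize (Polynomial.Chebyshev.U ℝ m).eval x = v
    push_cast
    field_simp
    linear_combination -(t : ℂ) * Complex.I_sq
  · have hs := (sign_mul_sqrt_sq hx).2
    rw [joukowskiPowDeriv, upperSqrt_mul_ofReal_of_lt_abs hx, joukowski_ofReal_of_lt_abs hx,
      extU_of_lt_abs hx, wT, if_neg hx.not_gt]
    push_cast
    ring

/-! ### The operators on single columns -/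

/-- The operators on a function `u` at its image: `h` is the Hilbert transform, `d` the derivative
and `r` the square root of the Laplacian, the latter two pointwise off `a` and `b` and weakly. -/
structure HasImages (a b : ℝ) (u h d r : ℝ → ℝ) : Prop where
  hasHilbertAt : ∀ x, HasHilbertAt u x (h x)
  hasDerivAt : ∀ x, x ≠ a → x ≠ b → HasDerivAt u (d x) x
  isWeakDeriv : IsWeakDeriv u d
  hasFracLaplacianAt : ∀ x, x ≠ a → x ≠ b → HasFracLaplacianAt (1 / 2) u x (r x)
  isFracLaplacian : IsFracLaplacian (1 / 2) u r

theorem IsBranched.hasImages {F : ℂ → ℂ} {F' : ℝ → ℂ} {a b c C : ℝ} (h : IsBranched F F' a b c C)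
    (L : ℂ →L[ℝ] ℝ) :
    HasImages a b (fun y => L (F y)) (fun x => L (-Complex.I * (F x - c))) (fun x => L (F' x))
      (fun x => L (-Complex.I * F' x)) :=
  ⟨h.hasHilbertAt L, fun _ => h.hasDerivAt L, h.isWeakDeriv L, fun _ => h.hasFracLaplacianAt L,
    h.isFracLaplacian L⟩

theorem ofReal_aff (a b x : ℝ) :
    (2 / (b - a) * (x - (a + b) / 2) : ℂ) = (aff a b x : ℝ) := by
  rw [aff]
  push_cast
  rfl

theorem abs_aff_ne_one {a b : ℝ} (hab : a < b) {x : ℝ} (ha : x ≠ a) (hb : x ≠ b) :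
    |aff a b x| ≠ 1 := by
  have h0 : b - a ≠ 0 := (sub_pos.2 hab).ne'
  intro h
  rcases eq_or_eq_neg_of_abs_eq h with h | h <;> rw [aff] at h <;> field_simp at h
  · exact hb (by linarith)
  · exact ha (by linarith)

/-- The powers of the transplanted inverse Joukowski map, with the derivative of the boundary
values in terms of the dual functions. The values of the derivative at the end points are
immaterial, and are chosen to be those of the dual functions. -/
theorem isBranched_succ {a b : ℝ} (hab : a < b) (m : ℕ) :
    ∃ C, IsBranched (fun z => joukowski (2 / (b - a) * (z - (a + b) / 2)) ^ (m + 1))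
      (fun x => ((2 * ((m : ℝ) + 1) / (b - a) : ℝ) : ℂ) *
        (extU (m + 2) (aff a b x) + Complex.I * wT (m + 1) (aff a b x))) a b 0 C := by
  have h := isBranched_joukowski_pow hab (m + 1)
  rw [if_neg m.succ_ne_zero] at h
  refine ⟨_, { h with hasDerivWithinAt := fun x ha hb => ?_ }⟩
  refine (h.hasDerivWithinAt x ha hb).congr_deriv ?_
  rw [joukowskiPowDeriv_eq m (abs_aff_ne_one hab ha hb)]
  push_cast
  ring

theorem hasImages_extT_zero {a b : ℝ} (hab : a < b) :
    HasImages a b (fun y => extT 0 (aff a b y)) 0 0 0 := by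
  convert (isBranched_joukowski_pow hab 0).hasImages Complex.reCLM using 1 <;> ext x <;>
    simp [extT_zero, joukowskiPowDeriv]

theorem hasImages_extT_succ {a b : ℝ} (hab : a < b) (m : ℕ) :
    HasImages a b (fun y => extT (m + 1) (aff a b y)) (fun x => -wU m (aff a b x))
      (fun x => 2 * ((m : ℝ) + 1) / (b - a) * extU (m + 2) (aff a b x))
      (fun x => 2 * ((m : ℝ) + 1) / (b - a) * wT (m + 1) (aff a b x)) := by
  obtain ⟨C, h⟩ := isBranched_succ hab m
  convert h.hasImages Complex.reCLM using 1 <;> ext x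
  · rw [ofReal_aff, joukowski_pow_ofReal]
    simp
  · rw [ofReal_aff, joukowski_pow_ofReal]
    simp
  · rw [Complex.reCLM_apply, Complex.re_ofReal_mul]
    simp
  · rw [Complex.reCLM_apply, mul_left_comm, Complex.re_ofReal_mul]
    simp

theorem hasImages_wU {a b : ℝ} (hab : a < b) (m : ℕ) :
    HasImages a b (fun y => wU m (aff a b y)) (fun x => extT (m + 1) (aff a b x))
      (fun x => -(2 * ((m : ℝ) + 1) / (b - a) * wT (m + 1) (aff a b x)))
      (fun x => 2 * ((m : ℝ) + 1) / (b - a) * extU (m + 2) (aff a b x)) := by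
  obtain ⟨C, h⟩ := isBranched_succ hab m
  convert h.hasImages (-Complex.imCLM) using 1 <;> ext x
  · rw [ofReal_aff, joukowski_pow_ofReal]
    simp
  · rw [ofReal_aff, joukowski_pow_ofReal]
    simp
  · rw [_root_.neg_apply, Complex.imCLM_apply, Complex.im_ofReal_mul]
    simp
  · rw [_root_.neg_apply, Complex.imCLM_apply, mul_left_comm, Complex.im_ofReal_mul]
    simp

/-! ### Column formulas for the band matrices -/

theorem vecMul_bandTwo (f : ℕ → Fin 2 → ℝ) (n : ℕ) (B : Matrix (Fin 2) (Fin 2) ℝ)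
    (q : Fin (n + 1) × Fin 2) :
    ((fun p : Fin (n + 3) × Fin 2 => f p.1 p.2) ᵥ* bandTwo n B) q =
      ∑ t, (f (q.1 + 2) t - f q.1 t) * (B t q.2 / 2) := by
  have hq := q.1.isLt
  have e : ∀ (p : Fin (n + 3)) (t : Fin 2), f p t * bandTwo n B (p, t) q =
      (if p = ⟨q.1 + 2, by omega⟩ then f (q.1 + 2) t * (B t q.2 / 2) else 0) -
        (if p = ⟨q.1, by omega⟩ then f q.1 t * (B t q.2 / 2) else 0) := by
    intro p t
    simp only [bandTwo, Matrix.of_apply, Fin.ext_iff]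
    split_ifs with h1 h2 h2
    · omega
    · rw [h1]; ring
    · rw [h2]; ring
    · ring
  simp only [Matrix.vecMul, dotProduct, Fintype.sum_prod_type]
  rw [Finset.sum_comm]
  refine Finset.sum_congr rfl fun t _ => ?_
  simp only [e, Finset.sum_sub_distrib, Finset.sum_ite_eq', Finset.mem_univ, if_true]
  ring

theorem vecMul_bandOne (f : ℕ → Fin 2 → ℝ) (a b : ℝ) (n : ℕ) (B : Matrix (Fin 2) (Fin 2) ℝ)
    (q : Fin (n + 1) × Fin 2) :
    ((fun p : Fin (n + 3) × Fin 2 => f p.1 p.2) ᵥ* bandOne a b n B) q =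
      ∑ t, f (q.1 + 1) t * (2 * ((q.1.val : ℝ) + 1) / (b - a) * B t q.2) := by
  have hq := q.1.isLt
  have e : ∀ (p : Fin (n + 3)) (t : Fin 2), f p t * bandOne a b n B (p, t) q =
      if p = ⟨q.1 + 1, by omega⟩ then
        f (q.1 + 1) t * (2 * ((q.1.val : ℝ) + 1) / (b - a) * B t q.2) else 0 := by
    intro p t
    simp only [bandOne, Matrix.of_apply, Fin.ext_iff]
    split_ifs with h1
    · rw [h1]
    · ring
  simp only [Matrix.vecMul, dotProduct, Fintype.sum_prod_type]
  rw [Finset.sum_comm]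
  refine Finset.sum_congr rfl fun t _ => ?_
  simp only [e, Finset.sum_ite_eq', Finset.mem_univ, if_true]

/-- The `j`-th block of the dual quasimatrix. -/
def dualBlock (a b x : ℝ) (j : ℕ) : Fin 2 → ℝ := ![wT j (aff a b x), extU (j + 1) (aff a b x)]

theorem dualSumSpace_comp_inr (a b : ℝ) (n : ℕ) (x : ℝ) :
    dualSumSpace a b n x ∘ Sum.inr = fun p => dualBlock a b x p.1 p.2 := rfl

theorem vecMul_fromBlocks_inr {m₁ m₂ k₁ k₂ : Type*} [Fintype m₁] [Fintype m₂]
    (v : m₁ ⊕ m₂ → ℝ) (A : Matrix m₁ k₁ ℝ) (C : Matrix m₂ k₁ ℝ) (D : Matrix m₂ k₂ ℝ) (q : k₂) :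
    (v ᵥ* fromBlocks A 0 C D) (Sum.inr q) = ((v ∘ Sum.inr) ᵥ* D) q := by
  simp [Matrix.vecMul_fromBlocks]

theorem wT_sub_wT (m : ℕ) (x : ℝ) : wT m x - wT (m + 2) x = 2 * wU m x := by
  unfold wT wU
  split_ifs with h
  · have h1 : 0 < 1 - x ^ 2 := by
      have := (sq_lt_one_iff_abs_lt_one x).2 h
      linarith
    have hs : √(1 - x ^ 2) ^ 2 = 1 - x ^ 2 := Real.sq_sqrt h1.le
    have hs0 : √(1 - x ^ 2) ≠ 0 := (Real.sqrt_pos.2 h1).ne'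
    have hT := congrArg (Polynomial.eval x)
      (Polynomial.Chebyshev.one_sub_X_sq_mul_U_eq_pol_in_T ℝ m)
    have hT2 := congrArg (Polynomial.eval x) (Polynomial.Chebyshev.T_add_two ℝ m)
    simp only [Polynomial.eval_sub, Polynomial.eval_mul, Polynomial.eval_X, Polynomial.eval_pow,
      Polynomial.eval_one, Polynomial.eval_ofNat] at hT hT2
    rw [show ((m + 2 : ℕ) : ℤ) = m + 2 by push_cast; rfl]
    field_simp
    rw [hs]
    linear_combination -2 * hT + hT2
  · simp

theorem vecMul_matE (a b : ℝ) (n : ℕ) (x : ℝ) (j : ColIdx n) :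
    (dualSumSpace a b n x ᵥ* matE n) j = sumSpace a b n x j := by
  rcases j with u | ⟨j, s⟩
  · simp only [matE, Matrix.vecMul_fromBlocks, Sum.elim_inl, Pi.add_apply, dualSumSpace_comp_inr,
      sumSpace]
    have e : ∀ (p : Fin (n + 3)) (t : Fin 2),
        dualBlock a b x p t * (if p.val = 1 ∧ t = 1 then 1 else 0) =
          if p = ⟨1, by omega⟩ then (if t = 1 then dualBlock a b x 1 1 else 0) else 0 := by
      intro p t
      simp only [Fin.ext_iff (a := p)]
      split_ifs <;> simp_all
    simp only [Matrix.vecMul, dotProduct, Matrix.of_apply, Fintype.sum_prod_type, e]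
    rw [Finset.sum_comm]
    simp [dualSumSpace, dualBlock, extU]
  · rw [matE, vecMul_fromBlocks_inr, dualSumSpace_comp_inr, vecMul_bandTwo, Fin.sum_univ_two]
    have h := wT_sub_wT j (aff a b x)
    fin_cases s
    · simp [dualBlock, blockN, sumSpace]
      linarith
    · simp [dualBlock, blockN, sumSpace, extU]
      ring

theorem vecMul_matH_inr (a b : ℝ) (n : ℕ) (x : ℝ) (j : Fin (n + 1)) (s : Fin 2) :
    (dualSumSpace a b n x ᵥ* matH n) (Sum.inr (j, s)) =
      ![extT (j + 1) (aff a b x), -wU j (aff a b x)] s := by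
  rw [matH, vecMul_fromBlocks_inr, dualSumSpace_comp_inr, vecMul_bandTwo, Fin.sum_univ_two]
  have h := wT_sub_wT j (aff a b x)
  fin_cases s
  · simp [dualBlock, blockM, extU]
    ring
  · simp [dualBlock, blockM]
    linarith

theorem vecMul_matD_inr (a b : ℝ) (n : ℕ) (x : ℝ) (j : Fin (n + 1)) (s : Fin 2) :
    (dualSumSpace a b n x ᵥ* matD a b n) (Sum.inr (j, s)) =
      ![-(2 * ((j.val : ℝ) + 1) / (b - a) * wT (j + 1) (aff a b x)),
        2 * ((j.val : ℝ) + 1) / (b - a) * extU (j + 2) (aff a b x)] s := by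
  rw [matD, vecMul_fromBlocks_inr, dualSumSpace_comp_inr, vecMul_bandOne, Fin.sum_univ_two]
  fin_cases s <;> simp [dualBlock, blockN, mul_comm]

theorem vecMul_matA_inr (a b : ℝ) (n : ℕ) (x : ℝ) (j : Fin (n + 1)) (s : Fin 2) :
    (dualSumSpace a b n x ᵥ* matA a b n) (Sum.inr (j, s)) =
      ![2 * ((j.val : ℝ) + 1) / (b - a) * extU (j + 2) (aff a b x),
        2 * ((j.val : ℝ) + 1) / (b - a) * wT (j + 1) (aff a b x)] s := by
  rw [matA, vecMul_fromBlocks_inr, dualSumSpace_comp_inr, vecMul_bandOne, Fin.sum_univ_two]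
  fin_cases s <;> simp [dualBlock, blockM, mul_comm]

/-- The operators act on the columns centred at one interval through its matrices. -/
theorem hasImages_sumSpace {a b : ℝ} (hab : a < b) (n : ℕ) (j : ColIdx n) :
    HasImages a b (fun y => sumSpace a b n y j) (fun x => (dualSumSpace a b n x ᵥ* matH n) j)
      (fun x => (dualSumSpace a b n x ᵥ* matD a b n) j)
      (fun x => (dualSumSpace a b n x ᵥ* matA a b n) j) := by
  rcases j with u | ⟨j, s⟩
  · convert hasImages_extT_zero hab using 1
    all_goals
      ext x
      first
        | rfl
        | simp [matH, matD, matA, Matrix.vecMul_fromBlocks]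
  · simp only [vecMul_matH_inr, vecMul_matD_inr, vecMul_matA_inr]
    fin_cases s
    · exact hasImages_wU hab j
    · exact hasImages_extT_succ hab j

/-! ### Several intervals -/

/-- Every column over several intervals is a column over one of them, and so is its image under a
block diagonal matrix. -/
theorem exists_col {K : ℕ} (a b : Fin (K + 1) → ℝ) (n : Fin (K + 1) → ℕ) (j : MultiCol n) :
    ∃ (k : Fin (K + 1)) (i : ColIdx (n k)),
      (∀ x, multiSumSpace a b n x j = sumSpace (a k) (b k) (n k) x i) ∧
      ∀ B : (k : Fin (K + 1)) → Matrix (RowIdx (n k)) (ColIdx (n k)) ℝ,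
        (∀ k, (B k).toBlocks₁₂ = 0) → ∀ x,
        (multiDualSumSpace a b n x ᵥ* multiBlock n B) j =
          (dualSumSpace (a k) (b k) (n k) x ᵥ* B k) i := by
  rcases j with j | ⟨k, q⟩
  · refine ⟨0, j, fun x => rfl, fun B hB x => ?_⟩
    simp only [multiBlock, Matrix.vecMul_fromBlocks, Sum.elim_inl, Matrix.vecMul_zero, add_zero]
    rfl
  · refine ⟨k.succ, Sum.inr q, fun x => rfl, fun B hB x => ?_⟩
    rw [multiBlock, vecMul_fromBlocks_inr]
    conv_rhs => rw [← Matrix.fromBlocks_toBlocks (B k.succ), hB, vecMul_fromBlocks_inr]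
    simp only [Matrix.vecMul, dotProduct, Fintype.sum_sigma]
    rw [Finset.sum_eq_single k]
    · simp only [Matrix.blockDiagonal'_apply_eq]
      rfl
    · intro l _ hl
      refine Finset.sum_eq_zero fun p _ => ?_
      rw [Matrix.blockDiagonal'_apply_ne _ _ _ hl, mul_zero]
    · simp

theorem multiBlock_add {K : ℕ} (n : Fin (K + 1) → ℕ)
    (B C : (k : Fin (K + 1)) → Matrix (RowIdx (n k)) (ColIdx (n k)) ℝ) :
    multiBlock n (fun k => B k + C k) = multiBlock n B + multiBlock n C := by
  ext (i | ⟨k, i⟩) (j | ⟨l, j⟩)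
  · simp [multiBlock]
  · simp [multiBlock]
  · simp [multiBlock]
  · rcases eq_or_ne k l with rfl | h
    · simp [multiBlock, Matrix.blockDiagonal'_apply_eq, Matrix.toBlocks₂₂]
    · simp [multiBlock, Matrix.blockDiagonal'_apply_ne _ _ _ h]

theorem multiBlock_smul {K : ℕ} (n : Fin (K + 1) → ℕ) (c : ℝ)
    (B : (k : Fin (K + 1)) → Matrix (RowIdx (n k)) (ColIdx (n k)) ℝ) :
    multiBlock n (fun k => c • B k) = c • multiBlock n B := by
  ext (i | ⟨k, i⟩) (j | ⟨l, j⟩)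
  · simp [multiBlock]
  · simp [multiBlock]
  · simp [multiBlock]
  · rcases eq_or_ne k l with rfl | h
    · simp [multiBlock, Matrix.blockDiagonal'_apply_eq, Matrix.toBlocks₂₂]
    · simp [multiBlock, Matrix.blockDiagonal'_apply_ne _ _ _ h]

/-! ### Linearity of the operators -/

theorem HasPrincipalValue.sum {ι : Type*} [Fintype ι] {f : ι → ℝ → ℝ} {x : ℝ} {v : ι → ℝ}
    (c : ι → ℝ) (h : ∀ i, HasPrincipalValue (f i) x (v i)) :
    HasPrincipalValue (fun y => ∑ i, f i y * c i) x (∑ i, v i * c i) := by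
  have hi : ∀ ε R : ℝ, 0 < ε → ∀ i, IntegrableOn (fun y => f i y * c i)
      {y | ε < |x - y| ∧ |x - y| < R} := fun ε R hε i => ((h i).1 ε R hε).mul_const (c i)
  refine ⟨fun ε R hε => integrable_finsetSum _ fun i _ => hi ε R hε i, ?_⟩
  refine (tendsto_finsetSum Finset.univ fun i _ => (h i).2.mul_const (c i)).congr' ?_
  filter_upwards [eventually_pos_le] with p hp
  rw [integral_finsetSum _ fun i _ => hi p.1 p.2 hp.1 i]
  simp only [integral_mul_const]

theorem HasHilbertAt.dotProduct {ι : Type*} [Fintype ι] {u : ℝ → ι → ℝ} {x : ℝ} {v : ι → ℝ}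
    (c : ι → ℝ) (h : ∀ i, HasHilbertAt (fun y => u y i) x (v i)) :
    HasHilbertAt (fun y => u y ⬝ᵥ c) x (v ⬝ᵥ c) := by
  choose I hI hv using h
  refine ⟨∑ i, I i * c i, ?_, ?_⟩
  · convert HasPrincipalValue.sum c hI using 2 with y
    simp only [_root_.dotProduct, Finset.sum_div]
    exact Finset.sum_congr rfl fun i _ => by ring
  · simp only [_root_.dotProduct, hv, Finset.mul_sum]
    exact Finset.sum_congr rfl fun i _ => by ring

theorem HasFracLaplacianAt.dotProduct {ι : Type*} [Fintype ι] {s : ℝ} {u : ℝ → ι → ℝ} {x : ℝ}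
    {v : ι → ℝ} (c : ι → ℝ) (h : ∀ i, HasFracLaplacianAt s (fun y => u y i) x (v i)) :
    HasFracLaplacianAt s (fun y => u y ⬝ᵥ c) x (v ⬝ᵥ c) := by
  choose I hI hv using h
  refine ⟨∑ i, I i * c i, ?_, ?_⟩
  · convert HasPrincipalValue.sum c hI using 2 with y
    simp only [_root_.dotProduct, ← Finset.sum_sub_distrib, Finset.sum_div]
    exact Finset.sum_congr rfl fun i _ => by ring
  · simp only [_root_.dotProduct, hv, Finset.mul_sum]
    exact Finset.sum_congr rfl fun i _ => by ring

theorem hasDerivAt_dotProduct {ι : Type*} [Fintype ι] {u : ℝ → ι → ℝ} {x : ℝ} {v : ι → ℝ}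
    (c : ι → ℝ) (h : ∀ i, HasDerivAt (fun y => u y i) (v i) x) :
    HasDerivAt (fun y => u y ⬝ᵥ c) (v ⬝ᵥ c) x :=
  HasDerivAt.fun_sum fun i _ => (h i).mul_const (c i)

end

end SumSpace

theorem mainTheorem3 {K : ℕ} (a b : Fin (K + 1) → ℝ) (hab : ∀ k, a k < b k)
    (hI : Pairwise fun k l => Disjoint (Set.Ioo (a k) (b k)) (Set.Ioo (a l) (b l)))
    (n : Fin (K + 1) → ℕ) :
    -- the identity
    (∀ x, multiSumSpace a b n x =
      multiDualSumSpace a b n x ᵥ* multiBlock n (fun k => matE (n k))) ∧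
    -- the Hilbert transform, column by column
    (∀ x j, HasHilbertAt (fun y => multiSumSpace a b n y j) x
      ((multiDualSumSpace a b n x ᵥ* multiBlock n (fun k => matH (n k))) j)) ∧
    -- the derivative, pointwise away from the end points and in the sense of distributions
    (∀ x, (∀ k, x ≠ a k ∧ x ≠ b k) → ∀ j, HasDerivAt (fun y => multiSumSpace a b n y j)
      ((multiDualSumSpace a b n x ᵥ* multiBlock n (fun k => matD (a k) (b k) (n k))) j) x) ∧
    (∀ j, IsWeakDeriv (fun y => multiSumSpace a b n y j)
      (fun x => (multiDualSumSpace a b n x ᵥ*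
        multiBlock n (fun k => matD (a k) (b k) (n k))) j)) ∧
    -- the sqrt-Laplacian, pointwise away from the end points and in the sense of distributions
    (∀ x, (∀ k, x ≠ a k ∧ x ≠ b k) → ∀ j,
      HasFracLaplacianAt (1 / 2) (fun y => multiSumSpace a b n y j) x
        ((multiDualSumSpace a b n x ᵥ* multiBlock n (fun k => matA (a k) (b k) (n k))) j)) ∧
    (∀ j, IsFracLaplacian (1 / 2) (fun y => multiSumSpace a b n y j)
      (fun x => (multiDualSumSpace a b n x ᵥ*
        multiBlock n (fun k => matA (a k) (b k) (n k))) j)) ∧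
    -- the combined operator is represented by one block per interval
    (∀ lam mu eta : ℝ,
      let L := multiBlock n (fun k => lam • matE (n k) + mu • matH (n k) +
        eta • matD (a k) (b k) (n k) + matA (a k) (b k) (n k))
      L = lam • multiBlock n (fun k => matE (n k)) + mu • multiBlock n (fun k => matH (n k)) +
          eta • multiBlock n (fun k => matD (a k) (b k) (n k)) +
          multiBlock n (fun k => matA (a k) (b k) (n k)) ∧
      ∀ (c : MultiCol n → ℝ) (x : ℝ), (∀ k, x ≠ a k ∧ x ≠ b k) →
        HasOperatorAt lam mu eta (fun y => multiSumSpace a b n y ⬝ᵥ c) x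
          (multiDualSumSpace a b n x ⬝ᵥ (L *ᵥ c))) := by
  have himg : ∀ j, ∃ k, HasImages (a k) (b k) (fun y => multiSumSpace a b n y j)
      (fun x => (multiDualSumSpace a b n x ᵥ* multiBlock n (fun k => matH (n k))) j)
      (fun x => (multiDualSumSpace a b n x ᵥ*
        multiBlock n (fun k => matD (a k) (b k) (n k))) j)
      (fun x => (multiDualSumSpace a b n x ᵥ*
        multiBlock n (fun k => matA (a k) (b k) (n k))) j) := by
    intro j
    obtain ⟨k, i, hS, hB⟩ := exists_col a b n j
    refine ⟨k, ?_⟩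
    simp only [hS, hB (fun k => matH (n k)) fun k => toBlocks_fromBlocks₁₂ _ _ _ _,
      hB (fun k => matD (a k) (b k) (n k)) fun k => toBlocks_fromBlocks₁₂ _ _ _ _,
      hB (fun k => matA (a k) (b k) (n k)) fun k => toBlocks_fromBlocks₁₂ _ _ _ _]
    exact hasImages_sumSpace (hab k) (n k) i
  have hE : ∀ x, multiSumSpace a b n x =
      multiDualSumSpace a b n x ᵥ* multiBlock n (fun k => matE (n k)) := by
    intro x
    ext j
    obtain ⟨k, i, hS, hB⟩ := exists_col a b n j
    rw [hS, hB (fun k => matE (n k)) fun k => toBlocks_fromBlocks₁₂ _ _ _ _, vecMul_matE]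
  have hH : ∀ x j, HasHilbertAt (fun y => multiSumSpace a b n y j) x
      ((multiDualSumSpace a b n x ᵥ* multiBlock n (fun k => matH (n k))) j) := by
    intro x j
    obtain ⟨k, h⟩ := himg j
    exact h.hasHilbertAt x
  have hD : ∀ x, (∀ k, x ≠ a k ∧ x ≠ b k) → ∀ j,
      HasDerivAt (fun y => multiSumSpace a b n y j) ((multiDualSumSpace a b n x ᵥ*
        multiBlock n (fun k => matD (a k) (b k) (n k))) j) x := by
    intro x hx j
    obtain ⟨k, h⟩ := himg j
    exact h.hasDerivAt x (hx k).1 (hx k).2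
  have hA : ∀ x, (∀ k, x ≠ a k ∧ x ≠ b k) → ∀ j,
      HasFracLaplacianAt (1 / 2) (fun y => multiSumSpace a b n y j) x
        ((multiDualSumSpace a b n x ᵥ* multiBlock n (fun k => matA (a k) (b k) (n k))) j) := by
    intro x hx j
    obtain ⟨k, h⟩ := himg j
    exact h.hasFracLaplacianAt x (hx k).1 (hx k).2
  refine ⟨hE, hH, hD, fun j => (himg j).elim fun k h => h.isWeakDeriv, hA,
    fun j => (himg j).elim fun k h => h.isFracLaplacian, fun lam mu eta => ?_⟩
  intro L
  have hL : L = lam • multiBlock n (fun k => matE (n k)) +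
      mu • multiBlock n (fun k => matH (n k)) +
      eta • multiBlock n (fun k => matD (a k) (b k) (n k)) +
      multiBlock n (fun k => matA (a k) (b k) (n k)) := by
    simp only [L, multiBlock_add, multiBlock_smul]
  refine ⟨hL, fun c x hx => ⟨_, _, _, HasHilbertAt.dotProduct c (hH x),
    hasDerivAt_dotProduct c (hD x hx), HasFracLaplacianAt.dotProduct c (hA x hx), ?_⟩⟩
  rw [hL, Matrix.dotProduct_mulVec]
  simp only [Matrix.vecMul_add, Matrix.vecMul_smul, add_dotProduct, smul_dotProduct, smul_eq_mul,
    ← hE x]
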